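/- **Setting.** Let $Q$ be a smooth manifold and $G$ a Lie group acting smoothly on the left on $Q$ so that the quotient map $\pi:Q\to Q/G$ is a smooth principal $G$-bundle. Let $(Q,L_d,\mathcal D,\mathcal D_d)$ be a nonholonomic discrete mechanical system: $L_d:Q\times Q\to\mathbb R$ is smooth, $\mathcal D\subset TQ$ is a subbundle and $\mathcal D_d\subset Q\times Q$ is a submanifold. Assume that $G$ is a symmetry group: $L_d$ and $\mathcal D_d$ are invariant under the diagonal action of $G$ on $Q\times Q$, and $\mathcal D$ is invariant under the lifted action on $TQ$. Let $\mathcal V^G_q=T_q(Gq)$. A $G$-invariant submanifold $Hor\subset Q\times Q$ defines an *affine discrete connection* of level $\gamma$, where $\gamma:Q\to G$ is smooth with $\gamma(gq)=g\gamma(q)g^{-1}$, if $\Gamma:=\{(q,\gamma(q)q)\}\subset Hor$ and, for each $q\in Q$, the set $Hor^2(q):=\{q_1:(q,q_1)\in Hor\}$ is a submanifold of $Q$ with $T_{q_1}Q=\mathcal V^G_{q_1}\oplus T_{q_1}Hor^2(q)$ for all $q_1\in Gq\cap Hor^2(q)$. $G$ is a *Chaplygin type symmetry group* if $TQ=\mathcal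 V^G\oplus\mathcal D$ and $\mathcal D_d$ defines an affine discrete connection, of some level $\gamma$. Let $h_q:T_{\pi(q)}(Q/G)\to\mathcal D_q$ be the horizontal lift of the connection with horizontal spaces $\mathcal D_q$, i.e. the inverse of $d\pi(q)|_{\mathcal D_q}$, and $Hor_{\mathcal A}=h_q\circ d\pi(q)$. Affine discrete connections need not be globally defined. Fix a $G$-invariant open neighborhood $U$ of $\Gamma$ in $Q\times Q$ (one may take $U=Q\times Q$ if the conditions below hold there) such that * for all $(q_0,q_1)$ there is at most one $g\in G$ with $(q_0,g^{-1}q_1)\in\mathcal D_d\cap U$, and * $T_{(q_0,q_1)}(Q\times Q)=(\{0\}\times\mathcal V^G_{q_1})\oplus T_{(q_0,q_1)}\mathcal D_d$ at every $(q_0,q_1)\in\mathcal D_d\cap U$. On the open set of the $(q_0,q_1)$ for which such a $g$ exists, write $\mathcal A_d(q_0,q_1):=g$. For $(q_0,r_1)\in Q\times Q/G$ let $\overline{h_d^{q_0}}(r_1)$ be the unique $q_1$ (when it exists) with $(q_0,q_1)\in\mathcal D_d\cap U$ and $\pi(q_1)=r_1$. Put $\tilde F_1(q_0,w_0,r_1):=w_0\,\overline{h_d^{q_0}}(r_1)$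 and $\check L_d(q_0,w_0,r_1):=L_d(q_0,\tilde F_1(q_0,w_0,r_1))$. Let $\tilde G:=(Q\times G)/G$ for the action $g(q,w)=(gq,gwg^{-1})$, with quotient map $\rho$. Define on $\tilde G\times(Q/G)$ $$\hat L_d(\rho(q_0,w_0),r_1):=\check L_d(q_0,w_0,r_1),$$ $$\hat F_d^-(\rho(q_0,w_0),r_1)(\delta r_0):=D_2\check L_d(q_0,w_0,r_1)\,\mathcal B_m^-(q_0,q_1)(h_{q_0}(\delta r_0)),$$ $$\hat F_d^+(\rho(q_0,w_0),r_1)(\delta r_1):=D_2\check L_d(q_0,w_0,r_1)\,\mathcal B_m^+(q_0,q_1)(h_{q_1}(\delta r_1)),$$ where $q_1:=\tilde F_1(q_0,w_0,r_1)$ and $\mathcal B_m^-=D_1\mathcal A_d\circ Hor_{\mathcal A}$, $\mathcal B_m^+=D_2\mathcal A_d\circ Hor_{\mathcal A}$ are the two components of the mixed curvature. With $\mathcal Y(r_0,r_1):=(\rho(q_0,e),r_1)$ for any $q_0\in\pi^{-1}(r_0)$, put $\breve L_d:=\hat L_d\circ\mathcal Y$ and $\breve F_d^\pm:=\mathcal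 Y^*\hat F_d^\pm$. **Theorem.** Let $G$ be a Chaplygin type symmetry group of $(Q,L_d,\mathcal D,\mathcal D_d)$ and $U$ as above. Let $q_\cdot=(q_0,\dots,q_N)$ be a discrete curve in $Q$ with $(q_k,q_{k+1})\in\mathcal D_d\cap U$ for $0\le k<N$, and let $r_k:=\pi(q_k)$. Let $S_d(q_\cdot)=\sum_{k=0}^{N-1}L_d(q_k,q_{k+1})$ and $\breve S_d(r_\cdot)=\sum_{k=0}^{N-1}\breve L_d(r_k,r_{k+1})$. The following are equivalent. 1. $dS_d(q_\cdot)(\delta q_\cdot)=0$ for all variations $\delta q_\cdot$ with $\delta q_0=0$, $\delta q_N=0$ and $\delta q_k\in\mathcal D_{q_k}$ for all $k$. 2. $D_1L_d(q_k,q_{k+1})+D_2L_d(q_{k-1},q_k)\in\mathcal D_{q_k}^\circ$ for $1\le k\le N-1$, and $(q_k,q_{k+1})\in\mathcal D_d$ for $0\le k<N$. 3. $d\breve S_d(r_\cdot)(\delta r_\cdot)=-\sum_{k=1}^{N-1}\big(\breve F_d^-(r_k,r_{k+1})+\breve F_d^+(r_{k-1},r_k)\big)(\delta r_k)$ for all variations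 $\delta r_\cdot$, $\delta r_k\in T_{r_k}(Q/G)$, with $\delta r_0=0$ and $\delta r_N=0$. 4. $D_1\breve L_d(r_k,r_{k+1})+D_2\breve L_d(r_{k-1},r_k)=-\big(\breve F_d^+(r_{k-1},r_k)+\breve F_d^-(r_k,r_{k+1})\big)$ for $1\le k\le N-1$. -/

import Mathlib

open scoped Manifold ContDiff

noncomputable section

set_option linter.unusedSectionVars false

namespace DiscreteMechanics

/-! ## Submanifolds and subbundles -/

section Submanifolds

variable {E : Type*} [NormedAddCommGroup E] [NormedSpace ℝ E]
  {H : Type*} [TopologicalSpace H] (I : ModelWithCorners ℝ E H)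
  {M : Type*} [TopologicalSpace M] [ChartedSpace H M]

/-- Near its point `x`, the set `S` is a regular level set `{f = 0}` of a smooth map `f` that is
submersive at `x`, and `T = ker df(x)` is the tangent space `T_x S`. -/
def HasTangentSpaceAt (S : Set M) (x : M) (T : Submodule ℝ (TangentSpace I x)) : Prop :=
  x ∈ S ∧ ∃ (m : ℕ) (W : Set M) (f : M → EuclideanSpace ℝ (Fin m)),
    IsOpen W ∧ x ∈ W ∧
    ContMDiffOn I 𝓘(ℝ, EuclideanSpace ℝ (Fin m)) ∞ f W ∧
    S ∩ W = {y | y ∈ W ∧ f y = 0} ∧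
    Function.Surjective (mfderiv I 𝓘(ℝ, EuclideanSpace ℝ (Fin m)) f x) ∧
    T = LinearMap.ker (mfderiv I 𝓘(ℝ, EuclideanSpace ℝ (Fin m)) f x).toLinearMap

/-- `S` is an (embedded, smooth) submanifold of `M`. -/
def IsSubmanifold (S : Set M) : Prop :=
  ∀ x ∈ S, ∃ T : Submodule ℝ (TangentSpace I x), HasTangentSpaceAt I S x T

/-- A family of subspaces of the tangent spaces is a smooth subbundle of the tangent bundle:
locally it is spanned by a smooth frame. -/
def IsSubbundle (D : ∀ x : M, Submodule ℝ (TangentSpace I x)) [IsManifold I ∞ M] : Prop :=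
  ∀ x : M, ∃ (W : Set M) (m : ℕ) (X : Fin m → ∀ y : M, TangentSpace I y),
    IsOpen W ∧ x ∈ W ∧
    (∀ i, ContMDiffOn I I.tangent ∞ (fun y => (⟨y, X i y⟩ : TangentBundle I M)) W) ∧
    ∀ y ∈ W, LinearIndependent ℝ (fun i => X i y) ∧
      D y = Submodule.span ℝ (Set.range fun i => X i y)

end Submanifolds

/-! ## Discrete mechanical systems and the differential of the discrete action -/

section Systems

variable (E : Type*) [NormedAddCommGroup E] [NormedSpace ℝ E]
  {M : Type*} [TopologicalSpace M] [ChartedSpace E M]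

/-- A nonholonomic discrete mechanical system `(Q, L_d, 𝒟, 𝒟_d)`. -/
structure NonholonomicSystem (Q : Type*) [TopologicalSpace Q] [ChartedSpace E Q]
    [IsManifold 𝓘(ℝ, E) ∞ Q] where
  /-- the discrete lagrangian `L_d` -/
  Ld : Q × Q → ℝ
  contMDiff_Ld : ContMDiff (𝓘(ℝ, E).prod 𝓘(ℝ, E)) 𝓘(ℝ, ℝ) ∞ Ld
  /-- the variational constraints `𝒟` -/
  D : ∀ q : Q, Submodule ℝ (TangentSpace 𝓘(ℝ, E) q)
  isSubbundle_D : IsSubbundle 𝓘(ℝ, E) D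
  /-- the discrete kinematic constraints `𝒟_d` -/
  Dd : Set (Q × Q)
  isSubmanifold_Dd : IsSubmanifold (𝓘(ℝ, E).prod 𝓘(ℝ, E)) Dd

/-- The differential `D₁ L (q₀, q₁)` with respect to the first component. -/
def D₁ (L : M × M → ℝ) (q₀ q₁ : M) : TangentSpace 𝓘(ℝ, E) q₀ →ₗ[ℝ] ℝ :=
  (mfderiv 𝓘(ℝ, E) 𝓘(ℝ, ℝ) (fun x => L (x, q₁)) q₀).toLinearMap

/-- The differential `D₂ L (q₀, q₁)` with respect to the second component. -/
def D₂ (L : M × M → ℝ) (q₀ q₁ : M) : TangentSpace 𝓘(ℝ, E) q₁ →ₗ[ℝ] ℝ :=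
  (mfderiv 𝓘(ℝ, E) 𝓘(ℝ, ℝ) (fun y => L (q₀, y)) q₁).toLinearMap

/-- The discrete action `S(q) = ∑_{k=0}^{N-1} L(q_k, q_{k+1})` of a discrete curve
`q : {0, …, N} → M`. -/
def action (L : M × M → ℝ) {N : ℕ} (q : Fin (N + 1) → M) : ℝ :=
  ∑ k : Fin N, L (q k.castSucc, q k.succ)

/-- The differential `dS(q)(δq)` of the discrete action, as a function on the product manifold
`M^{N+1}`, applied to a variation `δq` of the discrete curve `q`. -/
def dAction (L : M × M → ℝ) {N : ℕ} (q : Fin (N + 1) → M)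
    (δq : ∀ k, TangentSpace 𝓘(ℝ, E) (q k)) : ℝ :=
  mfderiv (ModelWithCorners.pi fun _ : Fin (N + 1) => 𝓘(ℝ, E)) 𝓘(ℝ, ℝ)
    (action L : (Fin (N + 1) → M) → ℝ) q δq

end Systems

/-- For `k < N - 1`, the first of the three consecutive indices `k`, `k + 1`, `k + 2` in
`{0, …, N}`; the middle one runs over the interior indices `1, …, N - 1`. -/
def prev {N : ℕ} (k : Fin (N - 1)) : Fin (N + 1) := ⟨k, by omega⟩

/-- The middle index `k + 1`. -/
def mid {N : ℕ} (k : Fin (N - 1)) : Fin (N + 1) := ⟨k + 1, by omega⟩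

/-- The last index `k + 2`. -/
def next {N : ℕ} (k : Fin (N - 1)) : Fin (N + 1) := ⟨k + 2, by omega⟩

/-! ## Symmetry groups, principal bundles and affine discrete connections -/

section Symmetry

variable (E EG EB : Type*) [NormedAddCommGroup E] [NormedSpace ℝ E]
  [NormedAddCommGroup EG] [NormedSpace ℝ EG] [NormedAddCommGroup EB] [NormedSpace ℝ EB]
  (G : Type*) [Group G] [TopologicalSpace G] [ChartedSpace EG G]
  {Q : Type*} [TopologicalSpace Q] [ChartedSpace E Q] [MulAction G Q]

/-- The quotient map `π : Q → Q/G`. -/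
def proj (q : Q) : MulAction.orbitRel.Quotient G Q := Quotient.mk _ q

variable (Q) in
/-- `G` acts smoothly on `Q` and, for the given smooth structure on the orbit space, the quotient
map `π : Q → Q/G` is a smooth principal `G`-bundle: around every point of `Q/G` there is a
trivialization `π⁻¹(W) → W × G` that is a diffeomorphism and `G`-equivariant. -/
structure IsPrincipalBundle [ChartedSpace EB (MulAction.orbitRel.Quotient G Q)] : Prop where
  contMDiff_smul : ContMDiff (𝓘(ℝ, EG).prod 𝓘(ℝ, E)) 𝓘(ℝ, E) ∞ (fun p : G × Q => p.1 • p.2)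
  exists_trivialization : ∀ r : MulAction.orbitRel.Quotient G Q,
    ∃ e : Bundle.Trivialization G (proj G : Q → MulAction.orbitRel.Quotient G Q), r ∈ e.baseSet ∧
      ContMDiffOn 𝓘(ℝ, E) (𝓘(ℝ, EB).prod 𝓘(ℝ, EG)) ∞ e e.source ∧
      ContMDiffOn (𝓘(ℝ, EB).prod 𝓘(ℝ, EG)) 𝓘(ℝ, E) ∞ e.toOpenPartialHomeomorph.symm e.target ∧
      ∀ q ∈ e.source, ∀ g : G, (e (g • q)).2 = g * (e q).2

/-- The lifted action `l^{TQ}_g : T_q Q → T_{g q} Q`. -/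
def liftedAction (g : G) (q : Q) :
    TangentSpace 𝓘(ℝ, E) q →L[ℝ] TangentSpace 𝓘(ℝ, E) (g • q) :=
  mfderiv 𝓘(ℝ, E) 𝓘(ℝ, E) (fun x : Q => g • x) q

/-- The tangent space `T_q(G q)` of the orbit through `q`: the fiber of the vertical bundle. -/
def vertical (q : Q) : Submodule ℝ (TangentSpace 𝓘(ℝ, E) q) :=
  LinearMap.range
    (mfderiv 𝓘(ℝ, EG) 𝓘(ℝ, E) (fun g : G => g • q) 1 : EG →L[ℝ] E).toLinearMap

/-- Invariance of a subset of `Q × Q` under the diagonal action of `G`. -/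
def DiagInvariant (H : Set (Q × Q)) : Prop :=
  ∀ (g : G) (q₀ q₁ : Q), (q₀, q₁) ∈ H → (g • q₀, g • q₁) ∈ H

/-- The invariance conditions for `G` to be a symmetry group of `(Q, L_d, 𝒟, 𝒟_d)`. -/
structure IsSymmetryGroup [IsManifold 𝓘(ℝ, E) ∞ Q] (S : NonholonomicSystem E Q) : Prop where
  Ld_smul : ∀ (g : G) (q₀ q₁ : Q), S.Ld (g • q₀, g • q₁) = S.Ld (q₀, q₁)
  D_smul : ∀ (g : G) (q : Q), ∀ v ∈ S.D q, liftedAction E G g q v ∈ S.D (g • q)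
  Dd_smul : DiagInvariant G S.Dd

variable {G}

/-- `Hor²(q) = {q₁ | (q, q₁) ∈ Hor}`. -/
def Hor2 (Hor : Set (Q × Q)) (q : Q) : Set Q := {q₁ | (q, q₁) ∈ Hor}

/-- `Hor ⊆ Q × Q` defines an affine discrete connection with level `γ : Q → G`. -/
structure IsAffineDiscreteConnection (γ : Q → G) (Hor : Set (Q × Q)) : Prop where
  contMDiff_level : ContMDiff 𝓘(ℝ, E) 𝓘(ℝ, EG) ∞ γ
  level_smul : ∀ (g : G) (q : Q), γ (g • q) = g * γ q * g⁻¹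
  isSubmanifold_Hor : IsSubmanifold (𝓘(ℝ, E).prod 𝓘(ℝ, E)) Hor
  diagInvariant_Hor : DiagInvariant G Hor
  level_subset : ∀ q : Q, (q, γ q • q) ∈ Hor
  isSubmanifold_Hor2 : ∀ q : Q, IsSubmanifold 𝓘(ℝ, E) (Hor2 Hor q)
  transversal : ∀ q : Q, ∀ q₁ ∈ MulAction.orbit G q ∩ Hor2 Hor q,
    ∃ T : Submodule ℝ (TangentSpace 𝓘(ℝ, E) q₁),
      HasTangentSpaceAt 𝓘(ℝ, E) (Hor2 Hor q) q₁ T ∧ IsCompl (vertical E EG G q₁) T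

/-- `U` is a `G`-invariant open neighborhood of the level `Γ = {(q, γ(q) q)}` on which the affine
discrete connection `Hor` has a (single valued, smooth) discrete connection form: every pair
`(q₀, q₁)` has at most one decomposition `q₁ = g • q₁'` with `(q₀, q₁') ∈ Hor ∩ U`, and `Hor ∩ U`
is transversal to the orbits in the second factor, i.e.
`T_{(q₀, q₁)}(Q × Q) = ({0} × T_{q₁}(G q₁)) ⊕ T_{(q₀, q₁)} Hor`. When the connection is globally
defined one can take `U = Q × Q`. -/
structure IsConnectionDomain (γ : Q → G) (Hor U : Set (Q × Q)) : Prop where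
  isOpen : IsOpen U
  diagInvariant : DiagInvariant G U
  level_mem : ∀ q : Q, (q, γ q • q) ∈ U
  unique : ∀ (q₀ q₁ : Q) (g : G), (q₀, q₁) ∈ Hor ∩ U → (q₀, g • q₁) ∈ Hor ∩ U → g = 1
  transversal : ∀ q₀ q₁ : Q, (q₀, q₁) ∈ Hor ∩ U →
    ∃ T : Submodule ℝ (TangentSpace (𝓘(ℝ, E).prod 𝓘(ℝ, E)) (q₀, q₁)),
      HasTangentSpaceAt (𝓘(ℝ, E).prod 𝓘(ℝ, E)) Hor (q₀, q₁) T ∧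
      IsCompl ((⊥ : Submodule ℝ (TangentSpace 𝓘(ℝ, E) q₀)).prod (vertical E EG G q₁)) T

/-- `G` is a Chaplygin type symmetry group of `(Q, L_d, 𝒟, 𝒟_d)`, where the affine discrete
connection defined by `𝒟_d` has level `γ`. -/
structure IsChaplyginSymmetryGroup [IsManifold 𝓘(ℝ, E) ∞ Q] (S : NonholonomicSystem E Q)
    (γ : Q → G) : Prop extends IsSymmetryGroup E G S where
  isCompl : ∀ q : Q, IsCompl (vertical E EG G q) (S.D q)
  isAffineDiscreteConnection : IsAffineDiscreteConnection E EG γ S.Dd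

end Symmetry

/-! ## The discrete connection form, lifts, and the reduced lagrangian

Here `H ⊆ Q × Q` stands for the horizontal space `Hor ∩ U` of an affine discrete connection,
restricted to the neighborhood `U` on which the connection form is defined. Outside of their natural
domains the maps below take (equivariant) default values. -/

section Reduction

variable {G : Type*} [Group G] {Q : Type*} [MulAction G Q]

open Classical in
variable (G) in
/-- The discrete connection form `𝒜_d(q₀, q₁)`: the unique `g` with `(q₀, g⁻¹ q₁) ∈ H`. -/
def connForm (H : Set (Q × Q)) (q₀ q₁ : Q) : G :=
  if h : ∃! g : G, (q₀, g⁻¹ • q₁) ∈ H then h.choose else 1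

open Classical in
/-- The second component of the discrete horizontal lift of `r₁` at `q₀`: the unique `q₁` with
`(q₀, q₁) ∈ H` and `π(q₁) = r₁`. -/
def discreteLift (H : Set (Q × Q)) (q₀ : Q) (r₁ : MulAction.orbitRel.Quotient G Q) : Q :=
  if h : ∃! q₁ : Q, (q₀, q₁) ∈ H ∧ proj G q₁ = r₁ then h.choose else q₀

/-- `F̃₁(q₀, w₀, r₁) = w₀ • (discrete horizontal lift of r₁ at q₀)`. -/
def tildeF₁ (H : Set (Q × Q)) (q₀ : Q) (w₀ : G) (r₁ : MulAction.orbitRel.Quotient G Q) : Q :=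
  w₀ • discreteLift H q₀ r₁

/-- `Ľ_d(q₀, w₀, r₁) = L_d(q₀, F̃₁(q₀, w₀, r₁))` on `Q × G × (Q/G)`. -/
def checkL (L : Q × Q → ℝ) (H : Set (Q × Q)) (q₀ : Q) (w₀ : G)
    (r₁ : MulAction.orbitRel.Quotient G Q) : ℝ :=
  L (q₀, tildeF₁ H q₀ w₀ r₁)

variable (G Q) in
/-- The orbit relation of the action `g (q, w) = (g q, g w g⁻¹)` on `Q × G`. -/
def conjSetoid : Setoid (Q × G) where
  r a b := ∃ g : G, g • a.1 = b.1 ∧ g * a.2 * g⁻¹ = b.2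
  iseqv :=
    { refl := fun a => ⟨1, by simp, by simp⟩
      symm := by
        rintro a b ⟨g, h1, h2⟩
        refine ⟨g⁻¹, ?_, ?_⟩
        · rw [← h1, inv_smul_smul]
        · rw [← h2]; group
      trans := by
        rintro a b c ⟨g, h1, h2⟩ ⟨k, h3, h4⟩
        refine ⟨k * g, ?_, ?_⟩
        · rw [← h3, ← h1, mul_smul]
        · rw [← h4, ← h2]; group }

variable (G Q) in
/-- The conjugate associated bundle `G̃ = (Q × G)/G`. -/
def ConjBundle : Type _ := Quotient (conjSetoid G Q)

/-- The quotient map `ρ : Q × G → G̃`. -/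
def rho (q : Q) (w : G) : ConjBundle G Q := Quotient.mk (conjSetoid G Q) (q, w)

/-- The map `G̃ → Q/G` induced by the first projection. -/
def ConjBundle.base (v : ConjBundle G Q) : MulAction.orbitRel.Quotient G Q :=
  Quotient.lift (s := conjSetoid G Q) (fun a => proj G a.1) (by
    rintro a b ⟨g, h1, -⟩
    rw [← h1]
    exact MulAction.orbitRel.Quotient.quotient_smul_eq.symm) v

/-- The map `𝒴 : (Q/G) × (Q/G) → G̃ × (Q/G)`, `𝒴(π(q₀), r₁) = (ρ(q₀, e), r₁)`. -/
def inclY (x : MulAction.orbitRel.Quotient G Q × MulAction.orbitRel.Quotient G Q) :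
    ConjBundle G Q × MulAction.orbitRel.Quotient G Q :=
  (Quotient.lift (fun q₀ : Q => rho q₀ (1 : G)) (by
    rintro a b ⟨g, h⟩
    exact Quotient.sound (s := conjSetoid G Q)
      ⟨g⁻¹, by rw [← h]; exact inv_smul_smul g b, by simp⟩) x.1, x.2)

section Equivariance

variable {H : Set (Q × Q)}

theorem DiagInvariant.inter {H' : Set (Q × Q)} (hH : DiagInvariant G H)
    (hH' : DiagInvariant G H') : DiagInvariant G (H ∩ H') :=
  fun g q₀ q₁ h => ⟨hH g q₀ q₁ h.1, hH' g q₀ q₁ h.2⟩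

theorem mem_smul_iff (hH : DiagInvariant G H) (g : G) (q₀ q₁ : Q) :
    (g • q₀, g • q₁) ∈ H ↔ (q₀, q₁) ∈ H :=
  ⟨fun h => by simpa using hH g⁻¹ _ _ h, hH g q₀ q₁⟩

theorem connForm_smul (hH : DiagInvariant G H) (g : G) (q₀ q₁ : Q) :
    connForm G H (g • q₀) (g • q₁) = g * connForm G H q₀ q₁ * g⁻¹ := by
  have key : ∀ k : G, (g • q₀, k⁻¹ • g • q₁) ∈ H ↔ (q₀, (g⁻¹ * k * g)⁻¹ • q₁) ∈ H := by
    intro k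
    rw [← mem_smul_iff hH g q₀]
    simp [mul_smul]
  unfold connForm
  by_cases h : ∃! k : G, (q₀, k⁻¹ • q₁) ∈ H
  · have h' : ∃! k : G, (g • q₀, k⁻¹ • g • q₁) ∈ H := by
      refine ⟨g * h.choose * g⁻¹, ?_, ?_⟩
      · have := h.choose_spec.1
        simp only [key]
        simpa [mul_assoc] using this
      · intro k hk
        have := h.choose_spec.2 _ ((key k).1 hk)
        rw [← this]; group
    rw [dif_pos h, dif_pos h']
    have := h.choose_spec.2 _ ((key _).1 h'.choose_spec.1)
    rw [← this]; group
  · have h' : ¬ ∃! k : G, (g • q₀, k⁻¹ • g • q₁) ∈ H := by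
      rintro ⟨k, hk, hu⟩
      refine h ⟨g⁻¹ * k * g, (key k).1 hk, fun l hl => ?_⟩
      have := hu (g * l * g⁻¹) ((key _).2 (by simpa [mul_assoc] using hl))
      rw [← this]; group
    rw [dif_neg h, dif_neg h']; simp

theorem discreteLift_smul (hH : DiagInvariant G H) (g : G) (q₀ : Q)
    (r₁ : MulAction.orbitRel.Quotient G Q) :
    discreteLift H (g • q₀) r₁ = g • discreteLift H q₀ r₁ := by
  have hp : ∀ (k : G) (q : Q), proj G (k • q) = proj G q := fun k q =>
    MulAction.orbitRel.Quotient.quotient_smul_eq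
  unfold discreteLift
  by_cases h : ∃! q₁ : Q, (q₀, q₁) ∈ H ∧ proj G q₁ = r₁
  · have h' : ∃! q₁ : Q, (g • q₀, q₁) ∈ H ∧ proj G q₁ = r₁ := by
      refine ⟨g • h.choose, ⟨hH g _ _ h.choose_spec.1.1, ?_⟩, ?_⟩
      · rw [hp]; exact h.choose_spec.1.2
      · rintro y ⟨hy1, hy2⟩
        have := h.choose_spec.2 (g⁻¹ • y)
          ⟨by simpa using hH g⁻¹ _ _ hy1, by rw [hp]; exact hy2⟩
        rw [← this]; simp
    rw [dif_pos h, dif_pos h']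
    have := h.choose_spec.2 (g⁻¹ • h'.choose)
      ⟨by simpa using hH g⁻¹ _ _ h'.choose_spec.1.1, by rw [hp]; exact h'.choose_spec.1.2⟩
    rw [← this]; simp
  · have h' : ¬ ∃! q₁ : Q, (g • q₀, q₁) ∈ H ∧ proj G q₁ = r₁ := by
      rintro ⟨y, ⟨hy1, hy2⟩, hu⟩
      refine h ⟨g⁻¹ • y, ⟨by simpa using hH g⁻¹ _ _ hy1, by rw [hp]; exact hy2⟩, ?_⟩
      rintro z ⟨hz1, hz2⟩
      have := hu (g • z) ⟨hH g _ _ hz1, by rw [hp]; exact hz2⟩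
      rw [← this]; simp
    rw [dif_neg h, dif_neg h']

theorem tildeF₁_smul (hH : DiagInvariant G H) (g : G) (q₀ : Q) (w₀ : G)
    (r₁ : MulAction.orbitRel.Quotient G Q) :
    tildeF₁ H (g • q₀) (g * w₀ * g⁻¹) r₁ = g • tildeF₁ H q₀ w₀ r₁ := by
  simp [tildeF₁, discreteLift_smul hH, mul_smul]

theorem checkL_smul {L : Q × Q → ℝ} (hL : ∀ (g : G) (q₀ q₁ : Q), L (g • q₀, g • q₁) = L (q₀, q₁))
    (hH : DiagInvariant G H) (g : G) (q₀ : Q) (w₀ : G) (r₁ : MulAction.orbitRel.Quotient G Q) :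
    checkL L H (g • q₀) (g * w₀ * g⁻¹) r₁ = checkL L H q₀ w₀ r₁ := by
  rw [checkL, tildeF₁_smul hH, hL, checkL]

end Equivariance

/-- The reduced lagrangian `L̂_d` on `G̃ × (Q/G)`, induced by `Ľ_d`:
`L̂_d(ρ(q₀, w₀), r₁) = Ľ_d(q₀, w₀, r₁)`. -/
def hatL (L : Q × Q → ℝ) (H : Set (Q × Q))
    (hL : ∀ (g : G) (q₀ q₁ : Q), L (g • q₀, g • q₁) = L (q₀, q₁)) (hH : DiagInvariant G H)
    (x : ConjBundle G Q × MulAction.orbitRel.Quotient G Q) : ℝ :=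
  Quotient.lift (s := conjSetoid G Q) (fun a => checkL L H a.1 a.2 x.2) (by
    rintro ⟨q, w⟩ ⟨q', w'⟩ ⟨g, h1, h2⟩
    obtain rfl : g • q = q' := h1
    obtain rfl : g * w * g⁻¹ = w' := h2
    exact (checkL_smul hL hH g q w x.2).symm) x.1

end Reduction

/-! ## The connection with horizontal spaces `𝒟`, mixed curvature and reduced forces -/

section Forces

variable (E EG EB : Type*) [NormedAddCommGroup E] [NormedSpace ℝ E]
  [NormedAddCommGroup EG] [NormedSpace ℝ EG] [NormedAddCommGroup EB] [NormedSpace ℝ EB]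
  {G : Type*} [Group G] [TopologicalSpace G] [ChartedSpace EG G]
  {Q : Type*} [TopologicalSpace Q] [ChartedSpace E Q] [MulAction G Q]
  [ChartedSpace EB (MulAction.orbitRel.Quotient G Q)]
  (D : ∀ q : Q, Submodule ℝ (TangentSpace 𝓘(ℝ, E) q))

variable (G) in
/-- The restriction of `dπ(q)` to the horizontal space `D q`. -/
def dprojHor (q : Q) : D q →ₗ[ℝ] TangentSpace 𝓘(ℝ, EB) (proj G q) :=
  (mfderiv 𝓘(ℝ, E) 𝓘(ℝ, EB) (proj G : Q → MulAction.orbitRel.Quotient G Q) q).toLinearMap ∘ₗ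
    (D q).subtype

open Classical in
variable (G) in
/-- The horizontal lift `h_q : T_{π(q)}(Q/G) → T_q Q` of the connection with horizontal spaces `D`:
`h_q(w)` is the element `v` of `D q` with `dπ(q)(v) = w`. -/
def horLift (q : Q) :
    TangentSpace 𝓘(ℝ, EB) (proj G q) →ₗ[ℝ] TangentSpace 𝓘(ℝ, E) q :=
  if h : Function.Bijective (dprojHor E EB G D q) then
    (D q).subtype ∘ₗ (LinearEquiv.ofBijective (dprojHor E EB G D q) h).symm.toLinearMap
  else 0

variable (G) in
/-- The horizontal part `Hor_𝒜(δq) = h_q(dπ(q)(δq))` of a tangent vector. -/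
def horPart (q : Q) : TangentSpace 𝓘(ℝ, E) q →ₗ[ℝ] TangentSpace 𝓘(ℝ, E) q :=
  horLift E EB G D q ∘ₗ
    (mfderiv 𝓘(ℝ, E) 𝓘(ℝ, EB) (proj G : Q → MulAction.orbitRel.Quotient G Q) q).toLinearMap

variable (G) in
/-- The component `ℬ_m⁻(q₀, q₁) = D₁𝒜_d(q₀, q₁) ∘ Hor_𝒜` of the mixed curvature. -/
def mixedCurvMinus (H : Set (Q × Q)) (q₀ q₁ : Q) :
    TangentSpace 𝓘(ℝ, E) q₀ →ₗ[ℝ] TangentSpace 𝓘(ℝ, EG) (connForm G H q₀ q₁) :=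
  (mfderiv 𝓘(ℝ, E) 𝓘(ℝ, EG) (fun x => connForm G H x q₁) q₀).toLinearMap ∘ₗ horPart E EB G D q₀

variable (G) in
/-- The component `ℬ_m⁺(q₀, q₁) = D₂𝒜_d(q₀, q₁) ∘ Hor_𝒜` of the mixed curvature. -/
def mixedCurvPlus (H : Set (Q × Q)) (q₀ q₁ : Q) :
    TangentSpace 𝓘(ℝ, E) q₁ →ₗ[ℝ] TangentSpace 𝓘(ℝ, EG) (connForm G H q₀ q₁) :=
  (mfderiv 𝓘(ℝ, E) 𝓘(ℝ, EG) (fun y => connForm G H q₀ y) q₁).toLinearMap ∘ₗ horPart E EB G D q₁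

/-- The differential `D₂Ľ_d(q₀, w₀, r₁)` with respect to the variable in `G`. -/
def D₂checkL (L : Q × Q → ℝ) (H : Set (Q × Q)) (q₀ : Q) (w₀ : G)
    (r₁ : MulAction.orbitRel.Quotient G Q) : TangentSpace 𝓘(ℝ, EG) w₀ →ₗ[ℝ] ℝ :=
  (mfderiv 𝓘(ℝ, EG) 𝓘(ℝ, ℝ) (fun w => checkL L H q₀ w r₁) w₀).toLinearMap

/-- `D₂Ľ_d(q₀, w₀, r₁) ∘ ℬ_m⁻(q₀, q₁) ∘ h_{q₀}` with `q₁ = F̃₁(q₀, w₀, r₁)`; on the domain of the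
connection form `w₀ = 𝒜_d(q₀, q₁)`. -/
def checkForceMinus (L : Q × Q → ℝ) (H : Set (Q × Q)) (q₀ : Q) (w₀ : G)
    (r₁ : MulAction.orbitRel.Quotient G Q) : TangentSpace 𝓘(ℝ, EB) (proj G q₀) →ₗ[ℝ] ℝ :=
  D₂checkL EG L H q₀ (connForm G H q₀ (tildeF₁ H q₀ w₀ r₁)) r₁ ∘ₗ
    mixedCurvMinus E EG EB G D H q₀ (tildeF₁ H q₀ w₀ r₁) ∘ₗ horLift E EB G D q₀

/-- `D₂Ľ_d(q₀, w₀, r₁) ∘ ℬ_m⁺(q₀, q₁) ∘ h_{q₁}` with `q₁ = F̃₁(q₀, w₀, r₁)`; on the domain of the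
connection form `w₀ = 𝒜_d(q₀, q₁)` and `π(q₁) = r₁`. -/
def checkForcePlus (L : Q × Q → ℝ) (H : Set (Q × Q)) (q₀ : Q) (w₀ : G)
    (r₁ : MulAction.orbitRel.Quotient G Q) : TangentSpace 𝓘(ℝ, EB) r₁ →ₗ[ℝ] ℝ :=
  (D₂checkL EG L H q₀ (connForm G H q₀ (tildeF₁ H q₀ w₀ r₁)) r₁ ∘ₗ
    mixedCurvPlus E EG EB G D H q₀ (tildeF₁ H q₀ w₀ r₁) ∘ₗ
    horLift E EB G D (tildeF₁ H q₀ w₀ r₁) : EB →ₗ[ℝ] ℝ)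

end Forces

section ForceEquivariance

variable {E EG EB : Type*} [NormedAddCommGroup E] [NormedSpace ℝ E]
  [NormedAddCommGroup EG] [NormedSpace ℝ EG] [NormedAddCommGroup EB] [NormedSpace ℝ EB]
  {G : Type*} [Group G] [TopologicalSpace G] [ChartedSpace EG G]
  {Q : Type*} [TopologicalSpace Q] [ChartedSpace E Q] [MulAction G Q]

/-- The chain rule for `f ∘ φ` with `φ` invertible; `f` need not be differentiable. -/
theorem mfderiv_comp_right {E₁ E₂ E₃ M₁ M₂ M₃ : Type*}
    [NormedAddCommGroup E₁] [NormedSpace ℝ E₁] [NormedAddCommGroup E₂] [NormedSpace ℝ E₂]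
    [NormedAddCommGroup E₃] [NormedSpace ℝ E₃] [TopologicalSpace M₁] [ChartedSpace E₁ M₁]
    [TopologicalSpace M₂] [ChartedSpace E₂ M₂] [TopologicalSpace M₃] [ChartedSpace E₃ M₃]
    {f : M₂ → M₃} {h : M₁ → M₃} {φ : M₁ → M₂} {ψ : M₂ → M₁}
    (hφ : MDifferentiable 𝓘(ℝ, E₁) 𝓘(ℝ, E₂) φ) (hψ : MDifferentiable 𝓘(ℝ, E₂) 𝓘(ℝ, E₁) ψ)
    (hψφ : ∀ x, ψ (φ x) = x) (hφψ : ∀ y, φ (ψ y) = y) (hh : ∀ x, f (φ x) = h x) (x : M₁)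
    (v : E₁) :
    (mfderiv 𝓘(ℝ, E₂) 𝓘(ℝ, E₃) f (φ x) : E₂ →L[ℝ] E₃)
      ((mfderiv 𝓘(ℝ, E₁) 𝓘(ℝ, E₂) φ x : E₁ →L[ℝ] E₂) v) =
      (mfderiv 𝓘(ℝ, E₁) 𝓘(ℝ, E₃) h x : E₁ →L[ℝ] E₃) v := by
  obtain rfl : f ∘ φ = h := funext hh
  by_cases hf : MDifferentiableAt 𝓘(ℝ, E₂) 𝓘(ℝ, E₃) f (φ x)
  · rw [mfderiv_comp x hf (hφ x)]; rfl
  · have hf' : ¬ MDifferentiableAt 𝓘(ℝ, E₁) 𝓘(ℝ, E₃) (f ∘ φ) x := by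
      intro hc
      apply hf
      have h2 : MDifferentiableAt 𝓘(ℝ, E₁) 𝓘(ℝ, E₃) (f ∘ φ) (ψ (φ x)) := by rwa [hψφ]
      have h1 := h2.comp (φ x) (hψ (φ x))
      have : (f ∘ φ) ∘ ψ = f := by funext y; simp [hφψ]
      rwa [this] at h1
    rw [mfderiv_zero_of_not_mdifferentiableAt hf, mfderiv_zero_of_not_mdifferentiableAt hf']
    rfl

/-- The chain rule for `φ ∘ f` with `φ` invertible; `f` need not be differentiable. -/
theorem mfderiv_comp_left {E₁ E₂ E₃ M₁ M₂ M₃ : Type*}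
    [NormedAddCommGroup E₁] [NormedSpace ℝ E₁] [NormedAddCommGroup E₂] [NormedSpace ℝ E₂]
    [NormedAddCommGroup E₃] [NormedSpace ℝ E₃] [TopologicalSpace M₁] [ChartedSpace E₁ M₁]
    [TopologicalSpace M₂] [ChartedSpace E₂ M₂] [TopologicalSpace M₃] [ChartedSpace E₃ M₃]
    {f : M₁ → M₂} {h : M₁ → M₃} {φ : M₂ → M₃} {ψ : M₃ → M₂}
    (hφ : MDifferentiable 𝓘(ℝ, E₂) 𝓘(ℝ, E₃) φ) (hψ : MDifferentiable 𝓘(ℝ, E₃) 𝓘(ℝ, E₂) ψ)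
    (hψφ : ∀ x, ψ (φ x) = x) (hh : ∀ x, φ (f x) = h x) (x : M₁) (v : E₁) :
    (mfderiv 𝓘(ℝ, E₂) 𝓘(ℝ, E₃) φ (f x) : E₂ →L[ℝ] E₃)
      ((mfderiv 𝓘(ℝ, E₁) 𝓘(ℝ, E₂) f x : E₁ →L[ℝ] E₂) v) =
      (mfderiv 𝓘(ℝ, E₁) 𝓘(ℝ, E₃) h x : E₁ →L[ℝ] E₃) v := by
  obtain rfl : φ ∘ f = h := funext hh
  by_cases hf : MDifferentiableAt 𝓘(ℝ, E₁) 𝓘(ℝ, E₂) f x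
  · rw [mfderiv_comp x (hφ (f x)) hf]; rfl
  · have hf' : ¬ MDifferentiableAt 𝓘(ℝ, E₁) 𝓘(ℝ, E₃) (φ ∘ f) x := by
      intro hc
      apply hf
      have h1 := (hψ ((φ ∘ f) x)).comp x hc
      have : ψ ∘ (φ ∘ f) = f := by funext y; simp [hψφ]
      rwa [this] at h1
    rw [mfderiv_zero_of_not_mdifferentiableAt hf, mfderiv_zero_of_not_mdifferentiableAt hf']
    exact map_zero (mfderiv 𝓘(ℝ, E₂) 𝓘(ℝ, E₃) φ (f x) : E₂ →L[ℝ] E₃)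

theorem mdifferentiable_smul
    (hsm : ContMDiff (𝓘(ℝ, EG).prod 𝓘(ℝ, E)) 𝓘(ℝ, E) ∞ (fun p : G × Q => p.1 • p.2)) (g : G) :
    MDifferentiable 𝓘(ℝ, E) 𝓘(ℝ, E) (fun q : Q => g • q) := by
  have : ContMDiff 𝓘(ℝ, E) 𝓘(ℝ, E) ∞ (fun q : Q => g • q) :=
    hsm.comp (contMDiff_const.prodMk contMDiff_id)
  exact this.mdifferentiable (by simp)

theorem mdifferentiable_conj [LieGroup 𝓘(ℝ, EG) ∞ G] (g : G) :
    MDifferentiable 𝓘(ℝ, EG) 𝓘(ℝ, EG) (fun w : G => g * w * g⁻¹) := by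
  have : ContMDiff 𝓘(ℝ, EG) 𝓘(ℝ, EG) ∞ (fun w : G => g * w * g⁻¹) :=
    (contMDiff_const.mul contMDiff_id).mul contMDiff_const
  exact this.mdifferentiable (by simp)

variable [ChartedSpace EB (MulAction.orbitRel.Quotient G Q)]
  {D : ∀ q : Q, Submodule ℝ (TangentSpace 𝓘(ℝ, E) q)}

theorem dproj_lifted
    (hsm : ContMDiff (𝓘(ℝ, EG).prod 𝓘(ℝ, E)) 𝓘(ℝ, E) ∞ (fun p : G × Q => p.1 • p.2))
    (g : G) (q : Q) (v : E) :
    (mfderiv 𝓘(ℝ, E) 𝓘(ℝ, EB) (proj G : Q → MulAction.orbitRel.Quotient G Q) (g • q) :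
      E →L[ℝ] EB) ((liftedAction E G g q : E →L[ℝ] E) v) =
    (mfderiv 𝓘(ℝ, E) 𝓘(ℝ, EB) (proj G : Q → MulAction.orbitRel.Quotient G Q) q :
      E →L[ℝ] EB) v :=
  mfderiv_comp_right (mdifferentiable_smul hsm g) (mdifferentiable_smul hsm g⁻¹)
    (fun x => inv_smul_smul g x) (fun x => smul_inv_smul g x)
    (fun _ => MulAction.orbitRel.Quotient.quotient_smul_eq) q v

theorem lifted_lifted
    (hsm : ContMDiff (𝓘(ℝ, EG).prod 𝓘(ℝ, E)) 𝓘(ℝ, E) ∞ (fun p : G × Q => p.1 • p.2))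
    (g : G) (q : Q) (v : E) :
    (liftedAction E G g⁻¹ (g • q) : E →L[ℝ] E) ((liftedAction E G g q : E →L[ℝ] E) v) = v := by
  have h : (liftedAction E G g⁻¹ (g • q) : E →L[ℝ] E) ((liftedAction E G g q : E →L[ℝ] E) v) =
      (mfderiv 𝓘(ℝ, E) 𝓘(ℝ, E) (id : Q → Q) q : E →L[ℝ] E) v :=
    mfderiv_comp_right (mdifferentiable_smul hsm g) (mdifferentiable_smul hsm g⁻¹)
      (fun x => inv_smul_smul g x) (fun x => smul_inv_smul g x)
      (fun x => inv_smul_smul g x) q v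
  rw [h, mfderiv_id]; rfl

theorem bijective_dprojHor_smul
    (hsm : ContMDiff (𝓘(ℝ, EG).prod 𝓘(ℝ, E)) 𝓘(ℝ, E) ∞ (fun p : G × Q => p.1 • p.2))
    (hD : ∀ (g : G) (q : Q), ∀ v ∈ D q, liftedAction E G g q v ∈ D (g • q)) (g : G) (q : Q)
    (h : Function.Bijective (dprojHor E EB G D q)) :
    Function.Bijective (dprojHor E EB G D (g • q)) := by
  constructor
  · rw [injective_iff_map_eq_zero]
    rintro ⟨v, hv⟩ h0
    have h1 := hD g⁻¹ (g • q) v hv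
    have h2 : (liftedAction E G g⁻¹ (g • q) : E →L[ℝ] E) v ∈ (D q : Submodule ℝ E) := by
      have : ∀ x : Q, x = q → ∀ w : E, w ∈ (D x : Submodule ℝ E) → w ∈ (D q : Submodule ℝ E) := by
        rintro x rfl w hw; exact hw
      exact this _ (inv_smul_smul g q) _ h1
    have h3 : dprojHor E EB G D q ⟨(liftedAction E G g⁻¹ (g • q) : E →L[ℝ] E) v, h2⟩ = 0 := by
      have h4 := dproj_lifted (EB := EB) hsm g⁻¹ (g • q) v
      have h5 : ∀ x : Q, x = q → ∀ w : E,
          (mfderiv 𝓘(ℝ, E) 𝓘(ℝ, EB) (proj G : Q → MulAction.orbitRel.Quotient G Q) x :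
            E →L[ℝ] EB) w =
          (mfderiv 𝓘(ℝ, E) 𝓘(ℝ, EB) (proj G : Q → MulAction.orbitRel.Quotient G Q) q :
            E →L[ℝ] EB) w := by
        rintro x rfl w; rfl
      exact ((h5 _ (inv_smul_smul g q) _).symm.trans h4).trans h0
    have h6 := (injective_iff_map_eq_zero _).1 h.1 _ h3
    have h7 : (liftedAction E G g⁻¹ (g • q) : E →L[ℝ] E) v = 0 := congrArg Subtype.val h6
    have h8 := lifted_lifted hsm g⁻¹ (g • q) v
    rw [h7] at h8
    apply Subtype.ext
    change v = (0 : E)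
    rw [← h8]
    exact map_zero (liftedAction E G g⁻¹⁻¹ (g⁻¹ • g • q) : E →L[ℝ] E)
  · intro w
    obtain ⟨⟨v, hv⟩, hw⟩ := h.2 w
    exact ⟨⟨liftedAction E G g q v, hD g q v hv⟩, (dproj_lifted (EB := EB) hsm g q v).trans hw⟩

theorem horLift_eq {q : Q} (h : Function.Bijective (dprojHor E EB G D q)) {w : EB} {v : E}
    (hv : v ∈ (D q : Submodule ℝ E))
    (hw : (mfderiv 𝓘(ℝ, E) 𝓘(ℝ, EB) (proj G : Q → MulAction.orbitRel.Quotient G Q) q :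
      E →L[ℝ] EB) v = w) :
    (horLift E EB G D q : EB →ₗ[ℝ] E) w = v := by
  have h1 : (LinearEquiv.ofBijective (dprojHor E EB G D q) h).symm w = ⟨v, hv⟩ :=
    (LinearEquiv.symm_apply_eq _).2 hw.symm
  rw [horLift, dif_pos h]
  exact congrArg Subtype.val h1

theorem horLift_smul
    (hsm : ContMDiff (𝓘(ℝ, EG).prod 𝓘(ℝ, E)) 𝓘(ℝ, E) ∞ (fun p : G × Q => p.1 • p.2))
    (hD : ∀ (g : G) (q : Q), ∀ v ∈ D q, liftedAction E G g q v ∈ D (g • q)) (g : G) (q : Q)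
    (w : EB) :
    (horLift E EB G D (g • q) : EB →ₗ[ℝ] E) w =
      (liftedAction E G g q : E →L[ℝ] E) ((horLift E EB G D q : EB →ₗ[ℝ] E) w) := by
  by_cases h : Function.Bijective (dprojHor E EB G D q)
  · obtain ⟨⟨v, hv⟩, hw⟩ := h.2 w
    rw [horLift_eq h hv hw]
    exact horLift_eq (bijective_dprojHor_smul hsm hD g q h) (hD g q v hv)
      ((dproj_lifted (EB := EB) hsm g q v).trans hw)
  · have h' : ¬ Function.Bijective (dprojHor E EB G D (g • q)) := by
      intro hc
      have := bijective_dprojHor_smul hsm hD g⁻¹ (g • q) hc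
      rw [inv_smul_smul] at this
      exact h this
    rw [horLift, dif_neg h', horLift, dif_neg h]
    exact (map_zero (liftedAction E G g q : E →L[ℝ] E)).symm

theorem horPart_horLift_smul
    (hsm : ContMDiff (𝓘(ℝ, EG).prod 𝓘(ℝ, E)) 𝓘(ℝ, E) ∞ (fun p : G × Q => p.1 • p.2))
    (hD : ∀ (g : G) (q : Q), ∀ v ∈ D q, liftedAction E G g q v ∈ D (g • q)) (g : G) (q : Q)
    (w : EB) :
    (horPart E EB G D (g • q) : E →ₗ[ℝ] E) ((horLift E EB G D (g • q) : EB →ₗ[ℝ] E) w) =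
      (liftedAction E G g q : E →L[ℝ] E)
        ((horPart E EB G D q : E →ₗ[ℝ] E) ((horLift E EB G D q : EB →ₗ[ℝ] E) w)) := by
  rw [horLift_smul hsm hD]
  exact (horLift_smul hsm hD g q _).trans (congrArg
    (fun x => (liftedAction E G g q : E →L[ℝ] E) ((horLift E EB G D q : EB →ₗ[ℝ] E) x))
    (dproj_lifted (EB := EB) hsm g q _))

variable {H : Set (Q × Q)}

theorem dconnForm_fst_smul [LieGroup 𝓘(ℝ, EG) ∞ G]
    (hsm : ContMDiff (𝓘(ℝ, EG).prod 𝓘(ℝ, E)) 𝓘(ℝ, E) ∞ (fun p : G × Q => p.1 • p.2))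
    (hH : DiagInvariant G H) (g : G) (q₀ q₁ : Q) (v : E) :
    (mfderiv 𝓘(ℝ, E) 𝓘(ℝ, EG) (fun x => connForm G H x (g • q₁)) (g • q₀) : E →L[ℝ] EG)
      ((liftedAction E G g q₀ : E →L[ℝ] E) v) =
    (mfderiv 𝓘(ℝ, EG) 𝓘(ℝ, EG) (fun w : G => g * w * g⁻¹) (connForm G H q₀ q₁) : EG →L[ℝ] EG)
      ((mfderiv 𝓘(ℝ, E) 𝓘(ℝ, EG) (fun x => connForm G H x q₁) q₀ : E →L[ℝ] EG) v) :=
  (mfderiv_comp_right (mdifferentiable_smul hsm g) (mdifferentiable_smul hsm g⁻¹)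
    (fun x => inv_smul_smul g x) (fun x => smul_inv_smul g x)
    (fun _ => rfl) q₀ v).trans
  (mfderiv_comp_left (f := fun x => connForm G H x q₁) (mdifferentiable_conj g)
    (mdifferentiable_conj g⁻¹) (fun w => by simp [mul_assoc])
    (fun x => (connForm_smul hH g x q₁).symm) q₀ v).symm

theorem dconnForm_snd_smul [LieGroup 𝓘(ℝ, EG) ∞ G]
    (hsm : ContMDiff (𝓘(ℝ, EG).prod 𝓘(ℝ, E)) 𝓘(ℝ, E) ∞ (fun p : G × Q => p.1 • p.2))
    (hH : DiagInvariant G H) (g : G) (q₀ q₁ : Q) (v : E) :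
    (mfderiv 𝓘(ℝ, E) 𝓘(ℝ, EG) (fun y => connForm G H (g • q₀) y) (g • q₁) : E →L[ℝ] EG)
      ((liftedAction E G g q₁ : E →L[ℝ] E) v) =
    (mfderiv 𝓘(ℝ, EG) 𝓘(ℝ, EG) (fun w : G => g * w * g⁻¹) (connForm G H q₀ q₁) : EG →L[ℝ] EG)
      ((mfderiv 𝓘(ℝ, E) 𝓘(ℝ, EG) (fun y => connForm G H q₀ y) q₁ : E →L[ℝ] EG) v) :=
  (mfderiv_comp_right (mdifferentiable_smul hsm g) (mdifferentiable_smul hsm g⁻¹)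
    (fun x => inv_smul_smul g x) (fun x => smul_inv_smul g x)
    (fun _ => rfl) q₁ v).trans
  (mfderiv_comp_left (f := fun y => connForm G H q₀ y) (mdifferentiable_conj g)
    (mdifferentiable_conj g⁻¹) (fun w => by simp [mul_assoc])
    (fun y => (connForm_smul hH g q₀ y).symm) q₁ v).symm

theorem D₂checkL_smul [LieGroup 𝓘(ℝ, EG) ∞ G] {L : Q × Q → ℝ}
    (hL : ∀ (g : G) (q₀ q₁ : Q), L (g • q₀, g • q₁) = L (q₀, q₁))
    (hH : DiagInvariant G H) (g : G) (q₀ : Q) (w₀ : G) (r₁ : MulAction.orbitRel.Quotient G Q)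
    (v : EG) :
    (D₂checkL EG L H (g • q₀) (g * w₀ * g⁻¹) r₁ : EG →ₗ[ℝ] ℝ)
      ((mfderiv 𝓘(ℝ, EG) 𝓘(ℝ, EG) (fun w : G => g * w * g⁻¹) w₀ : EG →L[ℝ] EG) v) =
    (D₂checkL EG L H q₀ w₀ r₁ : EG →ₗ[ℝ] ℝ) v :=
  mfderiv_comp_right (mdifferentiable_conj g) (mdifferentiable_conj g⁻¹)
    (fun w => by simp [mul_assoc]) (fun w => by simp [mul_assoc])
    (fun w => checkL_smul hL hH g q₀ w r₁) w₀ v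

theorem checkForceMinus_smul [LieGroup 𝓘(ℝ, EG) ∞ G] {L : Q × Q → ℝ}
    (hsm : ContMDiff (𝓘(ℝ, EG).prod 𝓘(ℝ, E)) 𝓘(ℝ, E) ∞ (fun p : G × Q => p.1 • p.2))
    (hD : ∀ (g : G) (q : Q), ∀ v ∈ D q, liftedAction E G g q v ∈ D (g • q))
    (hL : ∀ (g : G) (q₀ q₁ : Q), L (g • q₀, g • q₁) = L (q₀, q₁))
    (hH : DiagInvariant G H) (g : G) (q₀ : Q) (w₀ : G) (r₁ : MulAction.orbitRel.Quotient G Q) :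
    (checkForceMinus E EG EB D L H (g • q₀) (g * w₀ * g⁻¹) r₁ : EB →ₗ[ℝ] ℝ) =
      checkForceMinus E EG EB D L H q₀ w₀ r₁ := by
  refine LinearMap.ext fun (w : EB) => ?_
  unfold checkForceMinus
  rw [tildeF₁_smul hH, connForm_smul hH]
  generalize tildeF₁ H q₀ w₀ r₁ = q₁
  have h1 := D₂checkL_smul (EG := EG) hL hH g q₀ (connForm G H q₀ q₁) r₁
    ((mixedCurvMinus E EG EB G D H q₀ q₁ : E →ₗ[ℝ] EG)
      ((horLift E EB G D q₀ : EB →ₗ[ℝ] E) w))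
  have h2 : (mixedCurvMinus E EG EB G D H (g • q₀) (g • q₁) : E →ₗ[ℝ] EG)
      ((horLift E EB G D (g • q₀) : EB →ₗ[ℝ] E) w) =
      (mfderiv 𝓘(ℝ, EG) 𝓘(ℝ, EG) (fun w : G => g * w * g⁻¹) (connForm G H q₀ q₁) :
        EG →L[ℝ] EG) ((mixedCurvMinus E EG EB G D H q₀ q₁ : E →ₗ[ℝ] EG)
          ((horLift E EB G D q₀ : EB →ₗ[ℝ] E) w)) :=
    (congrArg (mfderiv 𝓘(ℝ, E) 𝓘(ℝ, EG) (fun x => connForm G H x (g • q₁)) (g • q₀) :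
      E →L[ℝ] EG) (horPart_horLift_smul hsm hD g q₀ w)).trans
      (dconnForm_fst_smul hsm hH g q₀ q₁ _)
  exact (congrArg (D₂checkL EG L H (g • q₀) (g * connForm G H q₀ q₁ * g⁻¹) r₁ : EG →ₗ[ℝ] ℝ)
    h2).trans h1

theorem checkForcePlus_smul [LieGroup 𝓘(ℝ, EG) ∞ G] {L : Q × Q → ℝ}
    (hsm : ContMDiff (𝓘(ℝ, EG).prod 𝓘(ℝ, E)) 𝓘(ℝ, E) ∞ (fun p : G × Q => p.1 • p.2))
    (hD : ∀ (g : G) (q : Q), ∀ v ∈ D q, liftedAction E G g q v ∈ D (g • q))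
    (hL : ∀ (g : G) (q₀ q₁ : Q), L (g • q₀, g • q₁) = L (q₀, q₁))
    (hH : DiagInvariant G H) (g : G) (q₀ : Q) (w₀ : G) (r₁ : MulAction.orbitRel.Quotient G Q) :
    (checkForcePlus E EG EB D L H (g • q₀) (g * w₀ * g⁻¹) r₁ : EB →ₗ[ℝ] ℝ) =
      checkForcePlus E EG EB D L H q₀ w₀ r₁ := by
  refine LinearMap.ext fun (w : EB) => ?_
  unfold checkForcePlus
  rw [tildeF₁_smul hH, connForm_smul hH]
  generalize tildeF₁ H q₀ w₀ r₁ = q₁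
  have h1 := D₂checkL_smul (EG := EG) hL hH g q₀ (connForm G H q₀ q₁) r₁
    ((mixedCurvPlus E EG EB G D H q₀ q₁ : E →ₗ[ℝ] EG)
      ((horLift E EB G D q₁ : EB →ₗ[ℝ] E) w))
  have h2 : (mixedCurvPlus E EG EB G D H (g • q₀) (g • q₁) : E →ₗ[ℝ] EG)
      ((horLift E EB G D (g • q₁) : EB →ₗ[ℝ] E) w) =
      (mfderiv 𝓘(ℝ, EG) 𝓘(ℝ, EG) (fun w : G => g * w * g⁻¹) (connForm G H q₀ q₁) :
        EG →L[ℝ] EG) ((mixedCurvPlus E EG EB G D H q₀ q₁ : E →ₗ[ℝ] EG)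
          ((horLift E EB G D q₁ : EB →ₗ[ℝ] E) w)) :=
    (congrArg (mfderiv 𝓘(ℝ, E) 𝓘(ℝ, EG) (fun y => connForm G H (g • q₀) y) (g • q₁) :
      E →L[ℝ] EG) (horPart_horLift_smul hsm hD g q₁ w)).trans
      (dconnForm_snd_smul hsm hH g q₀ q₁ _)
  exact (congrArg (D₂checkL EG L H (g • q₀) (g * connForm G H q₀ q₁ * g⁻¹) r₁ : EG →ₗ[ℝ] ℝ)
    h2).trans h1

end ForceEquivariance

/-! ## The reduced forces, and the reduced system on `Q/G` -/

section ReducedSystem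

variable {E EG EB : Type*} [NormedAddCommGroup E] [NormedSpace ℝ E]
  [NormedAddCommGroup EG] [NormedSpace ℝ EG] [NormedAddCommGroup EB] [NormedSpace ℝ EB]
  {G : Type*} [Group G] [TopologicalSpace G] [ChartedSpace EG G] [LieGroup 𝓘(ℝ, EG) ∞ G]
  {Q : Type*} [TopologicalSpace Q] [ChartedSpace E Q] [IsManifold 𝓘(ℝ, E) ∞ Q] [MulAction G Q]
  [ChartedSpace EB (MulAction.orbitRel.Quotient G Q)]
  (hP : IsPrincipalBundle E EG EB G Q) {S : NonholonomicSystem E Q} (hS : IsSymmetryGroup E G S)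
  {H : Set (Q × Q)} (hH : DiagInvariant G H)

/-- The component `F̂_d⁻(v₀, r₁)` of the reduced discrete force:
`F̂_d⁻(ρ(q₀, w₀), r₁) = D₂Ľ_d(q₀, w₀, r₁) ∘ D₁𝒜_d(q₀, q₁) ∘ h_{q₀}`, `q₁ = F̃₁(q₀, w₀, r₁)`. -/
def hatForceMinus (x : ConjBundle G Q × MulAction.orbitRel.Quotient G Q) :
    TangentSpace 𝓘(ℝ, EB) x.1.base →ₗ[ℝ] ℝ :=
  Quotient.lift (s := conjSetoid G Q)
    (fun a => (checkForceMinus E EG EB S.D S.Ld H a.1 a.2 x.2 : EB →ₗ[ℝ] ℝ)) (by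
    rintro ⟨q, w⟩ ⟨q', w'⟩ ⟨g, h1, h2⟩
    obtain rfl : g • q = q' := h1
    obtain rfl : g * w * g⁻¹ = w' := h2
    exact (checkForceMinus_smul hP.contMDiff_smul hS.D_smul hS.Ld_smul hH g q w x.2).symm) x.1

/-- The component `F̂_d⁺(v₀, r₁)` of the reduced discrete force:
`F̂_d⁺(ρ(q₀, w₀), r₁) = D₂Ľ_d(q₀, w₀, r₁) ∘ D₂𝒜_d(q₀, q₁) ∘ h_{q₁}`, `q₁ = F̃₁(q₀, w₀, r₁)`. -/
def hatForcePlus (x : ConjBundle G Q × MulAction.orbitRel.Quotient G Q) :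
    TangentSpace 𝓘(ℝ, EB) x.2 →ₗ[ℝ] ℝ :=
  Quotient.lift (s := conjSetoid G Q)
    (fun a => (checkForcePlus E EG EB S.D S.Ld H a.1 a.2 x.2 : EB →ₗ[ℝ] ℝ)) (by
    rintro ⟨q, w⟩ ⟨q', w'⟩ ⟨g, h1, h2⟩
    obtain rfl : g • q = q' := h1
    obtain rfl : g * w * g⁻¹ = w' := h2
    exact (checkForcePlus_smul hP.contMDiff_smul hS.D_smul hS.Ld_smul hH g q w x.2).symm) x.1

/-- The reduced lagrangian `L̆_d = L̂_d ∘ 𝒴` on `(Q/G) × (Q/G)`. -/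
def breveL : MulAction.orbitRel.Quotient G Q × MulAction.orbitRel.Quotient G Q → ℝ :=
  hatL S.Ld H hS.Ld_smul hH ∘ inclY

/-- The component `F̆_d⁻(r₀, r₁)` of the reduced force `F̆_d = 𝒴^* F̂_d`. -/
def breveForceMinus (r₀ r₁ : MulAction.orbitRel.Quotient G Q) :
    TangentSpace 𝓘(ℝ, EB) r₀ →ₗ[ℝ] ℝ :=
  (hatForceMinus hP hS hH (inclY (r₀, r₁)) : EB →ₗ[ℝ] ℝ)

/-- The component `F̆_d⁺(r₀, r₁)` of the reduced force `F̆_d = 𝒴^* F̂_d`. -/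
def breveForcePlus (r₀ r₁ : MulAction.orbitRel.Quotient G Q) :
    TangentSpace 𝓘(ℝ, EB) r₁ →ₗ[ℝ] ℝ :=
  hatForcePlus hP hS hH (inclY (r₀, r₁))

variable {γ : Q → G} {U : Set (Q × Q)} (hC : IsChaplyginSymmetryGroup E EG S γ)
  (hU : IsConnectionDomain E EG γ S.Dd U)

/-- `L̆_d` for a Chaplygin type symmetry group: the affine discrete connection is the one defined by
`𝒟_d`, on the domain determined by `U`. -/
def chaplyginL : MulAction.orbitRel.Quotient G Q × MulAction.orbitRel.Quotient G Q → ℝ :=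
  breveL hC.toIsSymmetryGroup (hC.Dd_smul.inter hU.diagInvariant)

/-- `F̆_d⁻` for a Chaplygin type symmetry group: the connection is the one with horizontal spaces
`𝒟` and the affine discrete connection is the one defined by `𝒟_d`. -/
def chaplyginForceMinus (r₀ r₁ : MulAction.orbitRel.Quotient G Q) :
    TangentSpace 𝓘(ℝ, EB) r₀ →ₗ[ℝ] ℝ :=
  breveForceMinus hP hC.toIsSymmetryGroup (hC.Dd_smul.inter hU.diagInvariant) r₀ r₁

/-- `F̆_d⁺` for a Chaplygin type symmetry group: the connection is the one with horizontal spaces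
`𝒟` and the affine discrete connection is the one defined by `𝒟_d`. -/
def chaplyginForcePlus (r₀ r₁ : MulAction.orbitRel.Quotient G Q) :
    TangentSpace 𝓘(ℝ, EB) r₁ →ₗ[ℝ] ℝ :=
  breveForcePlus hP hC.toIsSymmetryGroup (hC.Dd_smul.inter hU.diagInvariant) r₀ r₁

end ReducedSystem

end DiscreteMechanics

end

open DiscreteMechanics

set_option linter.unusedSectionVars false

namespace DiscreteMechanics

open Filter Topology

/-! ### Partial derivatives -/

/-! The reduction rests on one factorization. Near a point of `S.Dd ∩ U` every pair can be written
`y = 𝒜_d(x, y) • y'` with `(x, y')` horizontal, so `L_d(x, y) = Ľ_d(x, 𝒜_d(x, y), π(y))`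
(`checkL_connForm`). Transversality and the implicit function theorem make `𝒜_d` differentiable at
such a point (`exists_local_connForm`), so the chain rule applies. On the horizontal set itself `𝒜_d
= 1`.

Since `Ľ_d(x, 1, r) = L̆_d(π(x), r)`, the derivatives of `Ľ_d` in the outer variables give those of
`L̆_d` composed with `dπ`. The derivative in the group variable gives `D₂Ľ_d ∘ D𝒜_d`. On a vector `v
∈ 𝒟` the lift `h` inverts `dπ` and the horizontal part of `v` is `v`, so this term is precisely the
reduced force evaluated at `dπ(v)`. Thus `D₁L_d(v) = (D₁L̆_d + F̆_d⁻)(dπ v)` and `D₂L_d(v) = (D₂L̆_d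
+ F̆_d⁺)(dπ v)` for `v ∈ 𝒟` (`D₁_Ld_eq`, `D₂_Ld_eq`).

As `𝒟` complements the vertical bundle `ker dπ`, the map `dπ` sends `𝒟_q` isomorphically onto the
tangent space of the quotient (`bijective_dprojHor`). Vanishing on `𝒟_q` upstairs is therefore the
full covector equation downstairs. On each level, the variational and the pointwise formulations are
equivalent by regrouping the differential of the action around interior indices and testing
variations concentrated at one index (`dAction_eq_sum_mid`, `sum_mid_eq_zero_iff`). -/

theorem mfderiv_prod_apply {E₁ E₂ E₃ H₁ H₂ H₃ M₁ M₂ M₃ : Type*}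
    [NormedAddCommGroup E₁] [NormedSpace ℝ E₁] [NormedAddCommGroup E₂] [NormedSpace ℝ E₂]
    [NormedAddCommGroup E₃] [NormedSpace ℝ E₃] [TopologicalSpace H₁] [TopologicalSpace H₂]
    [TopologicalSpace H₃] {I₁ : ModelWithCorners ℝ E₁ H₁} {I₂ : ModelWithCorners ℝ E₂ H₂}
    {I₃ : ModelWithCorners ℝ E₃ H₃}
    [TopologicalSpace M₁] [ChartedSpace H₁ M₁] [TopologicalSpace M₂] [ChartedSpace H₂ M₂]
    [TopologicalSpace M₃] [ChartedSpace H₃ M₃] {F : M₁ × M₂ → M₃} {x : M₁} {y : M₂}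
    (h : MDifferentiableAt (I₁.prod I₂) I₃ F (x, y)) (v : E₁) (w : E₂) :
    (mfderiv (I₁.prod I₂) I₃ F (x, y) : E₁ × E₂ →L[ℝ] E₃) (v, w) =
      (mfderiv I₁ I₃ (fun a => F (a, y)) x : E₁ →L[ℝ] E₃) v +
        (mfderiv I₂ I₃ (fun b => F (x, b)) y : E₂ →L[ℝ] E₃) w := by
  have h1 : HasMFDerivAt I₁ I₃ (fun a => F (a, y)) x
      ((mfderiv (I₁.prod I₂) I₃ F (x, y) : E₁ × E₂ →L[ℝ] E₃).comp
        ((ContinuousLinearMap.id ℝ E₁).prod (0 : E₁ →L[ℝ] E₂))) :=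
    HasMFDerivAt.comp x h.hasMFDerivAt ((hasMFDerivAt_id x).prodMk (hasMFDerivAt_const y x))
  have h2 : HasMFDerivAt I₂ I₃ (fun b => F (x, b)) y
      ((mfderiv (I₁.prod I₂) I₃ F (x, y) : E₁ × E₂ →L[ℝ] E₃).comp
        ((0 : E₂ →L[ℝ] E₁).prod (ContinuousLinearMap.id ℝ E₂))) :=
    HasMFDerivAt.comp y h.hasMFDerivAt ((hasMFDerivAt_const x y).prodMk (hasMFDerivAt_id y))
  rw [h1.mfderiv, h2.mfderiv]
  have h3 : ∀ T : E₁ × E₂ →L[ℝ] E₃, T (v, w) = T (v, 0) + T (0, w) := fun T => by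
    rw [← map_add, Prod.mk_add_mk, add_zero, zero_add]
  exact h3 _

/-! ### The differential of the discrete action -/

section Action

variable {E : Type*} [NormedAddCommGroup E] [NormedSpace ℝ E]
  {M : Type*} [TopologicalSpace M] [ChartedSpace E M]

/-- The charts of a finite product are products of charts, so in coordinates evaluation is the
linear projection, at least on the chart target. -/
theorem hasMFDerivAt_eval {ι : Type*} [Fintype ι] (q : ι → M) (k : ι) :
    HasMFDerivAt (ModelWithCorners.pi fun _ : ι => 𝓘(ℝ, E)) 𝓘(ℝ, E)
      (fun x : ι → M => x k) q
      (ContinuousLinearMap.proj k : (ι → E) →L[ℝ] E) := by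
  refine ⟨(continuous_apply k).continuousAt, ?_⟩
  have h : HasFDerivWithinAt (fun v : ι → E => v k)
      (ContinuousLinearMap.proj k : (ι → E) →L[ℝ] E)
      (Set.range (ModelWithCorners.pi fun _ : ι => 𝓘(ℝ, E)))
      (extChartAt (ModelWithCorners.pi fun _ : ι => 𝓘(ℝ, E)) q q) :=
    (ContinuousLinearMap.proj k : (ι → E) →L[ℝ] E).hasFDerivAt.hasFDerivWithinAt
  refine h.congr_of_eventuallyEq ?_ ?_
  · filter_upwards [extChartAt_target_mem_nhdsWithin
      (I := ModelWithCorners.pi fun _ : ι => 𝓘(ℝ, E)) q] with v hv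
    have hv' : v k ∈ (chartAt E (q k)).target := by
      have : v ∈ (chartAt (ModelPi fun _ : ι => E) q).target := by
        rw [extChartAt_target] at hv
        exact hv.1
      exact this k (Set.mem_univ k)
    exact (chartAt E (q k)).right_inv hv'
  · exact (chartAt E (q k)).right_inv ((chartAt E (q k)).map_source (mem_chart_source E (q k)))

variable {N : ℕ} {L : M × M → ℝ} {q : Fin (N + 1) → M}

theorem mfderiv_prod_eq_D₁_add_D₂ {x y : M}
    (h : MDifferentiableAt (𝓘(ℝ, E).prod 𝓘(ℝ, E)) 𝓘(ℝ, ℝ) L (x, y)) (v w : E) :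
    (mfderiv (𝓘(ℝ, E).prod 𝓘(ℝ, E)) 𝓘(ℝ, ℝ) L (x, y) : E × E →L[ℝ] ℝ) (v, w) =
      (D₁ E L x y : E →ₗ[ℝ] ℝ) v + (D₂ E L x y : E →ₗ[ℝ] ℝ) w :=
  mfderiv_prod_apply h v w

theorem dAction_eq_sum
    (h : ∀ k : Fin N, MDifferentiableAt (𝓘(ℝ, E).prod 𝓘(ℝ, E)) 𝓘(ℝ, ℝ) L
      (q k.castSucc, q k.succ)) (δq : ∀ k, TangentSpace 𝓘(ℝ, E) (q k)) :
    dAction E L q δq =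
      ∑ k : Fin N, (D₁ E L (q k.castSucc) (q k.succ) (δq k.castSucc) +
        D₂ E L (q k.castSucc) (q k.succ) (δq k.succ)) := by
  have h1 : ∀ k : Fin N, HasMFDerivAt (ModelWithCorners.pi fun _ : Fin (N + 1) => 𝓘(ℝ, E))
      𝓘(ℝ, ℝ) (fun x : Fin (N + 1) → M => L (x k.castSucc, x k.succ)) q
      ((mfderiv (𝓘(ℝ, E).prod 𝓘(ℝ, E)) 𝓘(ℝ, ℝ) L (q k.castSucc, q k.succ) :
          E × E →L[ℝ] ℝ).comp
        ((ContinuousLinearMap.proj k.castSucc : (Fin (N + 1) → E) →L[ℝ] E).prod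
          (ContinuousLinearMap.proj k.succ : (Fin (N + 1) → E) →L[ℝ] E))) := fun k =>
    HasMFDerivAt.comp q (h k).hasMFDerivAt
      ((hasMFDerivAt_eval q k.castSucc).prodMk (hasMFDerivAt_eval q k.succ))
  have h2 := HasMFDerivAt.sum (t := Finset.univ) (fun k _ => h1 k)
  have h3 : (∑ k : Fin N, fun x : Fin (N + 1) → M => L (x k.castSucc, x k.succ)) =
      (action L : (Fin (N + 1) → M) → ℝ) := by
    funext x
    simp [action]
  rw [h3] at h2
  unfold dAction
  rw [h2.mfderiv]
  have h4 : ∀ (f : Fin N → (Fin (N + 1) → E) →L[ℝ] ℝ) (v : Fin (N + 1) → E),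
      (∑ k, f k) v = ∑ k, f k v := fun f v => by simp
  refine (h4 _ δq).trans (Finset.sum_congr rfl fun k _ => ?_)
  exact mfderiv_prod_eq_D₁_add_D₂ (h k) (δq k.castSucc) (δq k.succ)

/-- Discrete integration by parts: each interior point occurs once as a first and once as a second
argument of `L`, and fixed endpoints remove the boundary terms. -/
theorem dAction_eq_sum_mid
    (h : ∀ k : Fin N, MDifferentiableAt (𝓘(ℝ, E).prod 𝓘(ℝ, E)) 𝓘(ℝ, ℝ) L
      (q k.castSucc, q k.succ)) (δq : ∀ k, TangentSpace 𝓘(ℝ, E) (q k))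
    (h0 : δq 0 = 0) (hN : δq (Fin.last N) = 0) :
    dAction E L q δq =
      ∑ k : Fin (N - 1), (D₁ E L (q (mid k)) (q (next k)) + D₂ E L (q (prev k)) (q (mid k)))
        (δq (mid k)) := by
  rw [dAction_eq_sum h]
  match N with
  | 0 => rfl
  | n + 1 =>
    -- The `D₁` sum loses its first term and the `D₂` sum its last. The two remainders are then
    -- indexed so that their `k`-th terms both act on the variation at index `k + 1`.
    rw [Finset.sum_add_distrib, Fin.sum_univ_succ, Fin.sum_univ_castSucc (n := n)]
    have h0' : δq (Fin.castSucc (0 : Fin (n + 1))) = 0 := h0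
    have hN' : δq (Fin.succ (Fin.last n)) = 0 := hN
    rw [h0', hN', map_zero, map_zero, zero_add, add_zero, ← Finset.sum_add_distrib]
    rfl

/-- The fundamental lemma of the discrete calculus of variations. The family `D` is arbitrary so
that the lemma serves both the constrained problem on `Q` and, with `D = ⊤`, the free one on `Q/G`.
-/
theorem sum_mid_eq_zero_iff {D : ∀ x : M, Submodule ℝ (TangentSpace 𝓘(ℝ, E) x)}
    (c : ∀ k : Fin (N - 1), TangentSpace 𝓘(ℝ, E) (q (mid k)) →ₗ[ℝ] ℝ) :
    (∀ δq : ∀ k, TangentSpace 𝓘(ℝ, E) (q k), δq 0 = 0 → δq (Fin.last N) = 0 →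
      (∀ k, δq k ∈ D (q k)) → ∑ k, c k (δq (mid k)) = 0) ↔
    ∀ k, ∀ v ∈ D (q (mid k)), c k v = 0 := by
  constructor
  · intro h k v hv
    have h0 : mid k ≠ 0 := by
      intro h
      simpa [mid] using congrArg Fin.val h
    have hN : mid k ≠ Fin.last N := by
      intro h
      have := congrArg Fin.val h
      simp only [mid, Fin.val_last] at this
      omega
    -- A variation concentrated at one interior index is admissible: it vanishes at both ends, and
    -- zero lies in every `D`.
    have := h (Pi.single (mid k) v) (Pi.single_eq_of_ne h0.symm _)
      (Pi.single_eq_of_ne hN.symm _) (fun j => by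
        by_cases hj : j = mid k
        · subst hj
          rwa [Pi.single_eq_same]
        · rw [Pi.single_eq_of_ne hj]
          exact zero_mem _)
    rw [Finset.sum_eq_single k] at this
    · rwa [Pi.single_eq_same] at this
    · intro j _ hj
      have hne : mid j ≠ mid k := by
        intro h
        refine hj (Fin.ext ?_)
        simpa [mid] using congrArg Fin.val h
      rw [Pi.single_eq_of_ne hne, map_zero]
    · simp
  · intro h δq _ _ hD
    exact Finset.sum_eq_zero fun k _ => h k _ (hD _)

end Action

/-! ### The implicit function theorem on manifolds -/

/-- In charts this is the implicit function theorem in Banach spaces, with `X` as parameter and `G`,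
used only as a manifold, as the unknown. The solution is carried back through the inverse chart at
`g₀`. Absence of boundary makes the coordinate expression differentiable on a full neighborhood. -/
theorem exists_implicit_function {EX HX X EG G F : Type*}
    [NormedAddCommGroup EX] [NormedSpace ℝ EX] [CompleteSpace EX] [TopologicalSpace HX]
    {I : ModelWithCorners ℝ EX HX} [I.Boundaryless]
    [TopologicalSpace X] [ChartedSpace HX X] [IsManifold I 1 X]
    [NormedAddCommGroup EG] [NormedSpace ℝ EG] [CompleteSpace EG]
    [TopologicalSpace G] [ChartedSpace EG G] [IsManifold 𝓘(ℝ, EG) 1 G]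
    [NormedAddCommGroup F] [NormedSpace ℝ F] [CompleteSpace F]
    {Φ : X × G → F} {x₀ : X} {g₀ : G}
    (hΦ : ContMDiffAt (I.prod 𝓘(ℝ, EG)) 𝓘(ℝ, F) 1 Φ (x₀, g₀))
    (hb : Function.Bijective
      (mfderiv 𝓘(ℝ, EG) 𝓘(ℝ, F) (fun g => Φ (x₀, g)) g₀ : EG →L[ℝ] F)) :
    ∃ ψ : X → G, MDifferentiableAt I 𝓘(ℝ, EG) ψ x₀ ∧ ψ x₀ = g₀ ∧
      ∀ᶠ x in 𝓝 x₀, Φ (x, ψ x) = Φ (x₀, g₀) := by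
  set φ : EX × EG → F :=
    fun z => Φ ((extChartAt I x₀).symm z.1, (extChartAt 𝓘(ℝ, EG) g₀).symm z.2) with hφ
  set u : EX × EG := (extChartAt I x₀ x₀, extChartAt 𝓘(ℝ, EG) g₀ g₀) with hu
  have hd := hΦ.mdifferentiableAt one_ne_zero
  set f' : EX × EG →L[ℝ] F := mfderiv (I.prod 𝓘(ℝ, EG)) 𝓘(ℝ, F) Φ (x₀, g₀) with hf'
  have hrange : Set.range (I.prod 𝓘(ℝ, EG)) = Set.univ := by
    rw [ModelWithCorners.range_eq_univ]
  have hderiv : HasFDerivAt φ f' u := by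
    have h : HasFDerivWithinAt φ f' (Set.range (I.prod 𝓘(ℝ, EG))) u := hd.hasMFDerivAt.2
    rwa [hrange, hasFDerivWithinAt_univ] at h
  have hcd : ContDiffAt ℝ 1 φ u := by
    have := (contMDiffAt_iff.1 hΦ).2
    rw [hrange, contDiffWithinAt_univ] at this
    exact this
  have hs : HasStrictFDerivAt φ f' u := hcd.hasStrictFDerivAt' hderiv one_ne_zero
  have hbij : Function.Bijective (f' ∘L .inr ℝ EX EG) := by
    have h1 : (f' ∘L .inr ℝ EX EG) =
        (mfderiv 𝓘(ℝ, EG) 𝓘(ℝ, F) (fun g => Φ (x₀, g)) g₀ : EG →L[ℝ] F) := by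
      ext w
      have h2 : ∀ (T : EX →L[ℝ] F) (c : F), T 0 + c = c := fun T c => by simp
      exact (mfderiv_prod_apply hd (0 : EX) w).trans (h2 _ _)
    rwa [h1]
  have hinv : (f' ∘L .inr ℝ EX EG).IsInvertible :=
    ⟨ContinuousLinearEquiv.ofBijective (f' ∘L .inr ℝ EX EG)
      (LinearMap.ker_eq_bot.2 hbij.1) (LinearMap.range_eq_top.2 hbij.2),
      ContinuousLinearEquiv.coe_ofBijective _ _ _⟩
  set χ := hs.implicitFunctionOfProdDomain hinv with hχ
  -- The base point solves the equation itself, so local uniqueness forces the value of the implicit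
  -- function there.
  have hχ0 : χ (extChartAt I x₀ x₀) = extChartAt 𝓘(ℝ, EG) g₀ g₀ :=
    (hs.eventually_apply_eq_iff_implicitFunctionOfProdDomain hinv).self_of_nhds.mp rfl
  refine ⟨fun x => (extChartAt 𝓘(ℝ, EG) g₀).symm (χ (extChartAt I x₀ x)), ?_, ?_, ?_⟩
  · have h1 : MDifferentiableAt I 𝓘(ℝ, EX) (extChartAt I x₀) x₀ :=
      mdifferentiableAt_extChartAt (mem_chart_source HX x₀)
    have h2 : MDifferentiableAt 𝓘(ℝ, EX) 𝓘(ℝ, EG) χ (extChartAt I x₀ x₀) :=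
      (hs.hasStrictFDerivAt_implicitFunctionOfProdDomain
        hinv).hasFDerivAt.differentiableAt.mdifferentiableAt
    have h3 : MDifferentiableAt 𝓘(ℝ, EG) 𝓘(ℝ, EG) (extChartAt 𝓘(ℝ, EG) g₀).symm
        (χ (extChartAt I x₀ x₀)) := by
      rw [hχ0]
      exact ((contMDiffOn_extChartAt_symm (n := 1) g₀).contMDiffAt
        (extChartAt_target_mem_nhds g₀)).mdifferentiableAt one_ne_zero
    exact h3.comp x₀ (h2.comp x₀ h1)
  · change (extChartAt 𝓘(ℝ, EG) g₀).symm (χ (extChartAt I x₀ x₀)) = g₀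
    rw [hχ0, extChartAt_to_inv]
  · have h1 := (continuousAt_extChartAt (I := I) x₀).eventually
      (hs.eventually_apply_implicitFunctionOfProdDomain hinv)
    filter_upwards [h1, extChartAt_source_mem_nhds (I := I) x₀] with x hx hxs
    have h2 : φ (extChartAt I x₀ x, χ (extChartAt I x₀ x)) =
        Φ (x, (extChartAt 𝓘(ℝ, EG) g₀).symm (χ (extChartAt I x₀ x))) := by
      simp only [hφ]
      rw [(extChartAt I x₀).left_inv hxs]
    have h3 : φ u = Φ (x₀, g₀) := by
      simp only [hφ, hu, extChartAt_to_inv]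
    rw [← h2, ← h3]
    exact hx

/-! ### Smooth principal bundles -/

theorem proj_smul {G Q : Type*} [Group G] [MulAction G Q] (g : G) (q : Q) :
    proj G (g • q) = proj G q :=
  MulAction.orbitRel.Quotient.quotient_smul_eq

theorem exists_smul_eq_of_proj_eq {G Q : Type*} [Group G] [MulAction G Q] {x y : Q}
    (h : proj G x = proj G y) : ∃ g : G, g • y = x :=
  MulAction.orbitRel_apply.1 (Quotient.exact h)

section PrincipalBundle

variable {E EG EB : Type*} [NormedAddCommGroup E] [NormedSpace ℝ E]
  [NormedAddCommGroup EG] [NormedSpace ℝ EG] [NormedAddCommGroup EB] [NormedSpace ℝ EB]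
  {G : Type*} [Group G] [TopologicalSpace G] [ChartedSpace EG G]
  {Q : Type*} [TopologicalSpace Q] [ChartedSpace E Q] [MulAction G Q]

variable [ChartedSpace EB (MulAction.orbitRel.Quotient G Q)]

namespace IsPrincipalBundle

theorem contMDiff_proj (hP : IsPrincipalBundle E EG EB G Q) :
    ContMDiff 𝓘(ℝ, E) 𝓘(ℝ, EB) ∞ (proj G : Q → MulAction.orbitRel.Quotient G Q) := by
  intro q
  obtain ⟨e, he, hes, -, -⟩ := hP.exists_trivialization (proj G q)
  have hq : q ∈ e.source := e.mem_source.2 he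
  have h1 := (hes.contMDiffAt (e.open_source.mem_nhds hq)).fst
  refine h1.congr_of_eventuallyEq ?_
  filter_upwards [e.open_source.mem_nhds hq] with y hy
  exact (e.coe_fst hy).symm

/-- Around `q`, the bundle is trivialized by a local section `s` through `q` and the
`G`-component `k` relative to `s`. -/
theorem exists_local_section [LieGroup 𝓘(ℝ, EG) ∞ G] (hP : IsPrincipalBundle E EG EB G Q)
    (q : Q) :
    ∃ (s : MulAction.orbitRel.Quotient G Q → Q) (k : Q → G),
      ContMDiffAt 𝓘(ℝ, EB) 𝓘(ℝ, E) ∞ s (proj G q) ∧ ContMDiffAt 𝓘(ℝ, E) 𝓘(ℝ, EG) ∞ k q ∧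
      s (proj G q) = q ∧ (∀ᶠ r in 𝓝 (proj G q), proj G (s r) = r) ∧
      (∀ g : G, k (g • q) = g) ∧ ∀ᶠ y in 𝓝 q, k y • s (proj G y) = y := by
  obtain ⟨e, he, hes, hets, heq⟩ := hP.exists_trivialization (proj G q)
  have hq : q ∈ e.source := e.mem_source.2 he
  have hqt : (proj G q, (e q).2) ∈ e.target := e.mem_target.2 he
  have hmk : (proj G q, (e q).2) = e q := Prod.ext (e.coe_fst hq).symm rfl
  -- The section freezes the fiber coordinate at that of `q`. The group component is normalized on
  -- the right by the same coordinate, which is compatible with left equivariance and gives `k (g •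
  -- q) = g` for every `g`.
  refine ⟨fun r => e.toOpenPartialHomeomorph.symm (r, (e q).2), fun y => (e y).2 * (e q).2⁻¹,
    ?_, ?_, ?_, ?_, ?_, ?_⟩
  · have h1 := hets.contMDiffAt (e.open_target.mem_nhds hqt)
    exact ContMDiffAt.comp (proj G q) h1 (contMDiffAt_id.prodMk contMDiffAt_const)
  · exact (hes.contMDiffAt (e.open_source.mem_nhds hq)).snd.mul contMDiffAt_const
  · change e.toOpenPartialHomeomorph.symm (proj G q, (e q).2) = q
    rw [hmk]
    exact e.toOpenPartialHomeomorph.left_inv hq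
  · filter_upwards [e.open_baseSet.mem_nhds he] with r hr
    exact e.proj_symm_apply' hr
  · intro g
    change (e (g • q)).2 * (e q).2⁻¹ = g
    rw [heq q hq g, mul_inv_cancel_right]
  · filter_upwards [e.open_source.mem_nhds hq] with y hy
    have hb : proj G y ∈ e.baseSet := e.mem_source.1 hy
    have hz : e.toOpenPartialHomeomorph.symm (proj G y, (e q).2) ∈ e.source :=
      e.toOpenPartialHomeomorph.map_target (e.mem_target.2 hb)
    have hzp : proj G (e.toOpenPartialHomeomorph.symm (proj G y, (e q).2)) = proj G y :=
      e.proj_symm_apply' hb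
    have hz2 : (e (e.toOpenPartialHomeomorph.symm (proj G y, (e q).2))).2 = (e q).2 := by
      rw [e.apply_symm_apply' hb]
    have hsm : ∀ g : G, g • e.toOpenPartialHomeomorph.symm (proj G y, (e q).2) ∈ e.source :=
      fun g => e.mem_source.2 (by rw [proj_smul, hzp]; exact hb)
    -- Two points of the source with the same base point and the same fiber coordinate coincide.
    refine e.injOn (hsm _) hy (Prod.ext ?_ ?_)
    · exact (e.coe_fst (hsm _)).trans (((proj_smul _ _).trans hzp).trans (e.coe_fst hy).symm)
    · refine (heq _ hz _).trans ?_
      rw [hz2, inv_mul_cancel_right]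
      rfl

theorem contMDiff_orbit (hP : IsPrincipalBundle E EG EB G Q) (q : Q) :
    ContMDiff 𝓘(ℝ, EG) 𝓘(ℝ, E) ∞ (fun g : G => g • q) :=
  hP.contMDiff_smul.comp (contMDiff_id.prodMk contMDiff_const)

/-- The group component `k` of a local trivialization is a left inverse of the orbit map, so the
derivative of the orbit map has a left inverse too. -/
theorem injective_mfderiv_orbit [LieGroup 𝓘(ℝ, EG) ∞ G] (hP : IsPrincipalBundle E EG EB G Q)
    (q : Q) :
    Function.Injective (mfderiv 𝓘(ℝ, EG) 𝓘(ℝ, E) (fun g : G => g • q) 1 : EG →L[ℝ] E) := by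
  obtain ⟨s, k, -, hk, -, -, hkg, -⟩ := hP.exists_local_section q
  have hk1 : MDifferentiableAt 𝓘(ℝ, E) 𝓘(ℝ, EG) k ((fun g : G => g • q) 1) := by
    change MDifferentiableAt 𝓘(ℝ, E) 𝓘(ℝ, EG) k ((1 : G) • q)
    rw [one_smul]
    exact hk.mdifferentiableAt (by simp)
  have ho := (hP.contMDiff_orbit q).mdifferentiableAt (x := (1 : G)) (by simp)
  have hc := mfderiv_comp (1 : G) hk1 ho
  have hid : k ∘ (fun g : G => g • q) = id := funext hkg
  rw [hid, mfderiv_id] at hc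
  intro v w hvw
  have h1 : ∀ u : EG, u = (mfderiv 𝓘(ℝ, E) 𝓘(ℝ, EG) k ((fun g : G => g • q) 1) : E →L[ℝ] EG)
      ((mfderiv 𝓘(ℝ, EG) 𝓘(ℝ, E) (fun g : G => g • q) 1 : EG →L[ℝ] E) u) :=
    fun u => congrArg (fun T : EG →L[ℝ] EG => T u) hc
  exact (h1 v).trans ((congrArg _ hvw).trans (h1 w).symm)

/-- The projection is constant along orbits. The chain rule produces its derivative at `1 • q`,
which must be transported to `q`. -/
theorem mfderiv_proj_eq_zero_of_mem_vertical (hP : IsPrincipalBundle E EG EB G Q) (q : Q)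
    [LieGroup 𝓘(ℝ, EG) ∞ G] {v : E} (hv : v ∈ (vertical E EG G q : Submodule ℝ E)) :
    (mfderiv 𝓘(ℝ, E) 𝓘(ℝ, EB) (proj G : Q → MulAction.orbitRel.Quotient G Q) q :
      E →L[ℝ] EB) v = 0 := by
  obtain ⟨ξ, rfl⟩ := hv
  have ho := (hP.contMDiff_orbit q).mdifferentiableAt (x := (1 : G)) (by simp)
  have hp : HasMFDerivAt 𝓘(ℝ, E) 𝓘(ℝ, EB) (proj G : Q → MulAction.orbitRel.Quotient G Q)
      ((fun g : G => g • q) 1)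
      (mfderiv 𝓘(ℝ, E) 𝓘(ℝ, EB) (proj G : Q → MulAction.orbitRel.Quotient G Q) q :
        E →L[ℝ] EB) := by
    have h1 := (hP.contMDiff_proj.mdifferentiableAt (x := q) (by simp)).hasMFDerivAt
    have h2 : ∀ x : Q, x = q → HasMFDerivAt 𝓘(ℝ, E) 𝓘(ℝ, EB)
        (proj G : Q → MulAction.orbitRel.Quotient G Q) x
        (mfderiv 𝓘(ℝ, E) 𝓘(ℝ, EB) (proj G : Q → MulAction.orbitRel.Quotient G Q) q :
          E →L[ℝ] EB) := by
      rintro x rfl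
      exact h1
    exact h2 _ (one_smul G q)
  have hc := HasMFDerivAt.comp (1 : G) hp ho.hasMFDerivAt
  have hconst : (proj G : Q → MulAction.orbitRel.Quotient G Q) ∘ (fun g : G => g • q) =
      fun _ => proj G q := funext fun g => proj_smul g q
  rw [hconst] at hc
  exact congrArg (fun T : EG →L[ℝ] EB => T ξ) (hasMFDerivAt_unique hc (hasMFDerivAt_const _ _))

/-- Differentiate the local identity `y = k(y) • s(π(y))` at `q`. When `dπ(v) = 0` only the group
variable contributes, so `v` is the image of `dk(v)` under the derivative of the orbit map. -/
theorem mem_vertical_of_mfderiv_proj_eq_zero [LieGroup 𝓘(ℝ, EG) ∞ G]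
    (hP : IsPrincipalBundle E EG EB G Q) (q : Q) {v : E}
    (hv : (mfderiv 𝓘(ℝ, E) 𝓘(ℝ, EB) (proj G : Q → MulAction.orbitRel.Quotient G Q) q :
      E →L[ℝ] EB) v = 0) :
    v ∈ (vertical E EG G q : Submodule ℝ E) := by
  obtain ⟨s, k, hs, hk, hsq, -, hkg, hks⟩ := hP.exists_local_section q
  have hk1 : k q = 1 := by simpa using hkg 1
  have hp := hP.contMDiff_proj.mdifferentiableAt (x := q) (by simp)
  have hs' := hs.mdifferentiableAt (by simp)
  have hk' := hk.mdifferentiableAt (by simp)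
  have hsm := hP.contMDiff_smul.mdifferentiableAt (x := (k q, s (proj G q))) (by simp)
  have hc := HasMFDerivAt.comp q hsm.hasMFDerivAt
    (hk'.hasMFDerivAt.prodMk (HasMFDerivAt.comp q hs'.hasMFDerivAt hp.hasMFDerivAt))
  have hid := hasMFDerivAt_unique
    (hc.congr_of_eventuallyEq (f₁ := id) (hks.mono fun y hy => hy.symm)) (hasMFDerivAt_id q)
  set ξ : EG := (mfderiv 𝓘(ℝ, E) 𝓘(ℝ, EG) k q : E →L[ℝ] EG) v
  have h1 : (mfderiv (𝓘(ℝ, EG).prod 𝓘(ℝ, E)) 𝓘(ℝ, E) (fun p : G × Q => p.1 • p.2)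
      (k q, s (proj G q)) : EG × E →L[ℝ] E) (ξ,
        (mfderiv 𝓘(ℝ, EB) 𝓘(ℝ, E) s (proj G q) : EB →L[ℝ] E)
          ((mfderiv 𝓘(ℝ, E) 𝓘(ℝ, EB) (proj G : Q → MulAction.orbitRel.Quotient G Q) q :
            E →L[ℝ] EB) v)) = v :=
    congrArg (fun T : E →L[ℝ] E => T v) hid
  have h2 : ∀ (T : EB →L[ℝ] E) (R : EG × E →L[ℝ] E) (w : EB), w = 0 → R (ξ, 0) = R (ξ, T w) := by
    rintro T R w rfl
    rw [map_zero]
  have h3 : ∀ (T : EG →L[ℝ] E) (S : E →L[ℝ] E) (a : EG), T a + S 0 = T a := fun T S a => by simp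
  have h4 := (mfderiv_prod_apply hsm ξ (0 : E)).trans (h3 _ _ _)
  have h5 : ∀ (g : G) (x : Q), g = 1 → x = q →
      (mfderiv 𝓘(ℝ, EG) 𝓘(ℝ, E) (fun g : G => g • x) g : EG →L[ℝ] E) ξ ∈
        (vertical E EG G q : Submodule ℝ E) := by
    rintro g x rfl rfl
    exact ⟨ξ, rfl⟩
  have h6 := h4.symm.trans ((h2 _ _ _ hv).trans h1)
  rw [← h6]
  exact h5 _ _ hk1 hsq

/-- Differentiating `π ∘ s = id` for a local section `s` through `q` gives a right inverse. -/
theorem surjective_mfderiv_proj [LieGroup 𝓘(ℝ, EG) ∞ G]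
    (hP : IsPrincipalBundle E EG EB G Q) (q : Q) :
    Function.Surjective
      (mfderiv 𝓘(ℝ, E) 𝓘(ℝ, EB) (proj G : Q → MulAction.orbitRel.Quotient G Q) q :
        E →L[ℝ] EB) := by
  obtain ⟨s, k, hs, -, hsq, hps, -, -⟩ := hP.exists_local_section q
  have hp : HasMFDerivAt 𝓘(ℝ, E) 𝓘(ℝ, EB) (proj G : Q → MulAction.orbitRel.Quotient G Q)
      (s (proj G q))
      (mfderiv 𝓘(ℝ, E) 𝓘(ℝ, EB) (proj G : Q → MulAction.orbitRel.Quotient G Q) q :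
        E →L[ℝ] EB) := by
    have h2 : ∀ x : Q, x = q → HasMFDerivAt 𝓘(ℝ, E) 𝓘(ℝ, EB)
        (proj G : Q → MulAction.orbitRel.Quotient G Q) x
        (mfderiv 𝓘(ℝ, E) 𝓘(ℝ, EB) (proj G : Q → MulAction.orbitRel.Quotient G Q) q :
          E →L[ℝ] EB) := by
      rintro x rfl
      exact (hP.contMDiff_proj.mdifferentiableAt (by simp)).hasMFDerivAt
    exact h2 _ hsq
  have hc := HasMFDerivAt.comp (proj G q) hp (hs.mdifferentiableAt (by simp)).hasMFDerivAt
  have hid := hasMFDerivAt_unique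
    (hc.congr_of_eventuallyEq (f₁ := id) (hps.mono fun y hy => hy.symm)) (hasMFDerivAt_id _)
  exact fun w => ⟨_, congrArg (fun T : EB →L[ℝ] EB => T w) hid⟩

/-- The kernel of the surjection `dπ(q)` is the vertical space, so its restriction to any complement
is bijective. Consequently `horLift` is never in its default branch under the Chaplygin hypothesis.
-/
theorem bijective_dprojHor [LieGroup 𝓘(ℝ, EG) ∞ G] (hP : IsPrincipalBundle E EG EB G Q)
    {D : ∀ q : Q, Submodule ℝ (TangentSpace 𝓘(ℝ, E) q)} {q : Q}
    (hD : IsCompl (vertical E EG G q) (D q)) : Function.Bijective (dprojHor E EB G D q) := by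
  constructor
  · rw [injective_iff_map_eq_zero]
    rintro ⟨v, hv⟩ h0
    have h1 : v ∈ vertical E EG G q := hP.mem_vertical_of_mfderiv_proj_eq_zero q h0
    exact Subtype.ext (Submodule.disjoint_def.1 hD.disjoint v h1 hv)
  · intro w
    obtain ⟨v, hv⟩ := hP.surjective_mfderiv_proj q w
    obtain ⟨a, b, ha, hb, rfl⟩ := Submodule.codisjoint_iff_exists_add_eq.1 hD.codisjoint v
    refine ⟨⟨b, hb⟩, ?_⟩
    have h0 := hP.mfderiv_proj_eq_zero_of_mem_vertical q ha
    have h1 : ∀ (T : E →L[ℝ] EB) (a b : E), T a = 0 → T (a + b) = T b := fun T a b h => by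
      rw [map_add, h, zero_add]
    exact (h1 _ a b h0).symm.trans hv

end IsPrincipalBundle

end PrincipalBundle

/-! ### The discrete connection form and the discrete horizontal lift near `Hor ∩ U` -/

section ConnectionForm

variable {G : Type*} [Group G] {Q : Type*} [MulAction G Q] {H : Set (Q × Q)}

/-- Two candidates `g` and `k` give horizontal points `g⁻¹ • y` and `k⁻¹ • y` differing by `k⁻¹ *
g`, which `hu` forces to be `1`. Exhibiting one candidate therefore excludes the default value. -/
theorem connForm_eq_of_mem
    (hu : ∀ (x y : Q) (g : G), (x, y) ∈ H → (x, g • y) ∈ H → g = 1) {x y : Q} {g : G}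
    (h : (x, g⁻¹ • y) ∈ H) : connForm G H x y = g := by
  have huniq : ∀ k : G, (x, k⁻¹ • y) ∈ H → k = g := by
    intro k hk
    have := hu x (g⁻¹ • y) (k⁻¹ * g) h (by simpa [smul_smul] using hk)
    exact (inv_mul_eq_one.1 this)
  have hex : ∃! g : G, (x, g⁻¹ • y) ∈ H := ⟨g, h, huniq⟩
  rw [connForm, dif_pos hex]
  exact huniq _ hex.choose_spec.1

theorem discreteLift_eq_of_mem
    (hu : ∀ (x y : Q) (g : G), (x, y) ∈ H → (x, g • y) ∈ H → g = 1) {x y : Q}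
    {r : MulAction.orbitRel.Quotient G Q} (h : (x, y) ∈ H) (hr : proj G y = r) :
    discreteLift H x r = y := by
  have huniq : ∀ z : Q, (x, z) ∈ H ∧ proj G z = r → z = y := by
    rintro z ⟨hz, hzr⟩
    obtain ⟨g, rfl⟩ := exists_smul_eq_of_proj_eq (hzr.trans hr.symm)
    rw [hu x y g h hz, one_smul]
  have hex : ∃! z : Q, (x, z) ∈ H ∧ proj G z = r := ⟨y, ⟨h, hr⟩, huniq⟩
  rw [discreteLift, dif_pos hex]
  exact huniq _ hex.choose_spec.1

/-- The factorization of `L` behind the reduction: the horizontal lift of `π(y)` at `x` is `𝒜_d(x,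
y)⁻¹ • y`, and acting by `𝒜_d(x, y)` recovers `y`. -/
theorem checkL_connForm
    (hu : ∀ (x y : Q) (g : G), (x, y) ∈ H → (x, g • y) ∈ H → g = 1) (L : Q × Q → ℝ) {x y : Q}
    (h : (x, (connForm G H x y)⁻¹ • y) ∈ H) :
    checkL L H x (connForm G H x y) (proj G y) = L (x, y) := by
  rw [checkL, tildeF₁, discreteLift_eq_of_mem hu h (proj_smul _ _), smul_inv_smul]

end ConnectionForm

/-! ### Differentiability of the discrete connection form, the discrete lift and `Ľ_d`. -/

section ConnectionDomain

variable {E EG EB : Type*} [NormedAddCommGroup E] [NormedSpace ℝ E]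
  [NormedAddCommGroup EG] [NormedSpace ℝ EG]
  [NormedAddCommGroup EB] [NormedSpace ℝ EB]
  {G : Type*} [Group G] [TopologicalSpace G] [ChartedSpace EG G]
  {Q : Type*} [TopologicalSpace Q] [ChartedSpace E Q] [MulAction G Q]

namespace IsConnectionDomain

variable {γ : Q → G} {Hor U : Set (Q × Q)}

theorem connForm_eq_one (hU : IsConnectionDomain E EG γ Hor U) {q₀ q₁ : Q}
    (h : (q₀, q₁) ∈ Hor ∩ U) : connForm G (Hor ∩ U) q₀ q₁ = 1 :=
  connForm_eq_of_mem hU.unique (by simpa using h)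

theorem discreteLift_proj (hU : IsConnectionDomain E EG γ Hor U) {q₀ q₁ : Q}
    (h : (q₀, q₁) ∈ Hor ∩ U) : discreteLift (Hor ∩ U) q₀ (proj G q₁) = q₁ :=
  discreteLift_eq_of_mem hU.unique h rfl

variable [ChartedSpace EB (MulAction.orbitRel.Quotient G Q)]
  [FiniteDimensional ℝ E] [FiniteDimensional ℝ EG]
  [LieGroup 𝓘(ℝ, EG) ∞ G] [IsManifold 𝓘(ℝ, E) ∞ Q]

/-- With `f` a local defining map of `Hor`, solve `f(x, g • y) = 0` for `g` near `1`. The partial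
derivative in `g` is `df` restricted to `{0} × 𝒱` after the injective derivative of the orbit map.
It is bijective because `{0} × 𝒱` is a complement of `ker df`. The solution is later identified with
`connForm` by uniqueness. -/
theorem exists_local_connForm (hP : IsPrincipalBundle E EG EB G Q)
    (hU : IsConnectionDomain E EG γ Hor U) {q₀ q₁ : Q} (h : (q₀, q₁) ∈ Hor ∩ U) :
    ∃ A : Q × Q → G, MDifferentiableAt (𝓘(ℝ, E).prod 𝓘(ℝ, E)) 𝓘(ℝ, EG) A (q₀, q₁) ∧
      ∀ᶠ z : Q × Q in 𝓝 (q₀, q₁), (z.1, (A z)⁻¹ • z.2) ∈ Hor ∩ U := by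
  have : CompleteSpace E := FiniteDimensional.complete ℝ E
  have : CompleteSpace EG := FiniteDimensional.complete ℝ EG
  have : IsManifold 𝓘(ℝ, E) 1 Q := IsManifold.of_le (n := ∞) (by simp)
  have : IsManifold 𝓘(ℝ, EG) 1 G := IsManifold.of_le (n := ∞) (by simp)
  obtain ⟨T, ⟨-, m, W, f, hWo, hW, hf, hHW, hsurj, rfl⟩, hT⟩ := hU.transversal q₀ q₁ h
  have hfat : ContMDiffAt (𝓘(ℝ, E).prod 𝓘(ℝ, E)) 𝓘(ℝ, EuclideanSpace ℝ (Fin m)) ∞ f (q₀, q₁) :=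
    hf.contMDiffAt (hWo.mem_nhds hW)
  have hfd := hfat.mdifferentiableAt (by simp)
  have hf1 : f (q₀, q₁) = 0 := by
    have : (q₀, q₁) ∈ Hor ∩ W := ⟨h.1, hW⟩
    rw [hHW] at this
    exact this.2
  set a : (Q × Q) × G → Q × Q := fun p => (p.1.1, p.2 • p.1.2) with ha
  have ha1 : a ((q₀, q₁), 1) = (q₀, q₁) := by simp [ha]
  have has : ContMDiff ((𝓘(ℝ, E).prod 𝓘(ℝ, E)).prod 𝓘(ℝ, EG)) (𝓘(ℝ, E).prod 𝓘(ℝ, E)) ∞ a :=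
    (contMDiff_fst.fst).prodMk (hP.contMDiff_smul.comp (contMDiff_snd.prodMk contMDiff_fst.snd))
  have hΦ : ContMDiffAt ((𝓘(ℝ, E).prod 𝓘(ℝ, E)).prod 𝓘(ℝ, EG))
      𝓘(ℝ, EuclideanSpace ℝ (Fin m)) 1 (f ∘ a) ((q₀, q₁), 1) := by
    refine ContMDiffAt.comp _ ?_ (has.contMDiffAt.of_le (by simp))
    rw [ha1]
    exact hfat.of_le (by simp)
  set df : E × E →L[ℝ] EuclideanSpace ℝ (Fin m) :=
    mfderiv (𝓘(ℝ, E).prod 𝓘(ℝ, E)) 𝓘(ℝ, EuclideanSpace ℝ (Fin m)) f (q₀, q₁) with hdf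
  set orb : EG →L[ℝ] E := mfderiv 𝓘(ℝ, EG) 𝓘(ℝ, E) (fun g : G => g • q₁) 1 with horb
  have hpartial : HasMFDerivAt 𝓘(ℝ, EG) 𝓘(ℝ, EuclideanSpace ℝ (Fin m))
      (fun g : G => (f ∘ a) ((q₀, q₁), g)) 1 (df.comp ((0 : EG →L[ℝ] E).prod orb)) := by
    have h1 : HasMFDerivAt 𝓘(ℝ, EG) 𝓘(ℝ, E) (fun g : G => g • q₁) 1 orb :=
      ((hP.contMDiff_orbit q₁).mdifferentiableAt (by simp)).hasMFDerivAt
    have h2 : HasMFDerivAt 𝓘(ℝ, EG) (𝓘(ℝ, E).prod 𝓘(ℝ, E))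
        (fun g : G => a ((q₀, q₁), g)) 1 ((0 : EG →L[ℝ] E).prod orb) :=
      (hasMFDerivAt_const q₀ 1).prodMk h1
    have h3 : ∀ z : Q × Q, z = (q₀, q₁) → HasMFDerivAt (𝓘(ℝ, E).prod 𝓘(ℝ, E))
        𝓘(ℝ, EuclideanSpace ℝ (Fin m)) f z df := by
      rintro z rfl
      exact hfd.hasMFDerivAt
    exact HasMFDerivAt.comp 1 (h3 _ ha1) h2
  have hinj := hP.injective_mfderiv_orbit q₁
  have hb : Function.Bijective (df.comp ((0 : EG →L[ℝ] E).prod orb)) := by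
    have hmem : ∀ ξ : EG, ((0 : E), orb ξ) ∈
        ((⊥ : Submodule ℝ E).prod (vertical E EG G q₁) : Submodule ℝ (E × E)) :=
      fun ξ => ⟨rfl, ξ, rfl⟩
    constructor
    · rw [injective_iff_map_eq_zero]
      intro ξ hξ
      have h1 : ((0 : E), orb ξ) = (0 : E × E) :=
        Submodule.disjoint_def.1 hT.disjoint _ (hmem ξ) hξ
      exact hinj ((congrArg Prod.snd h1).trans (map_zero orb).symm)
    · intro c
      obtain ⟨v, hv⟩ : ∃ v, df v = c := hsurj c
      obtain ⟨y, z, hy, hz, hyz⟩ := Submodule.codisjoint_iff_exists_add_eq.1 hT.codisjoint v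
      obtain ⟨y1, y2⟩ := y
      obtain ⟨hy1, ξ, rfl⟩ := hy
      obtain rfl : y1 = 0 := hy1
      refine ⟨ξ, ?_⟩
      have h1 : ∀ (D : E × E →L[ℝ] EuclideanSpace ℝ (Fin m)) (u w : E × E), D w = 0 →
          D u = D (u + w) := fun D u w hw => by rw [map_add, hw, add_zero]
      exact (h1 df (0, orb ξ) z hz).trans ((congrArg df hyz).trans hv)
  obtain ⟨ψ, hψ, hψ1, hev⟩ := exists_implicit_function
    (I := 𝓘(ℝ, E).prod 𝓘(ℝ, E)) hΦ (by rw [hpartial.mfderiv]; exact hb)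
  -- The connection form asks for `g⁻¹ • y` to be horizontal, whereas `ψ z • y` is, hence the
  -- inverse.
  refine ⟨fun z => (ψ z)⁻¹, ?_, ?_⟩
  · have hinv := (contMDiff_inv 𝓘(ℝ, EG) ∞ (G := G)).mdifferentiableAt (x := ψ (q₀, q₁)) (by simp)
    exact hinv.comp _ hψ
  · have hcont : ContinuousAt (fun z : Q × Q => a (z, ψ z)) (q₀, q₁) := by
      refine ContinuousAt.comp (g := a) has.continuous.continuousAt
        (continuousAt_id.prodMk hψ.continuousAt)
    have hval : a ((q₀, q₁), ψ (q₀, q₁)) = (q₀, q₁) := by rw [hψ1, ha1]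
    -- The moved pair must stay in `W`, where the zero set of `f` is `Hor`, and in the open set `U`.
    have hnhds : W ∩ U ∈ 𝓝 (a ((q₀, q₁), ψ (q₀, q₁))) := by
      rw [hval]
      exact (hWo.inter hU.isOpen).mem_nhds ⟨hW, h.2⟩
    filter_upwards [hev, hcont.eventually_mem hnhds] with z hz hzW
    have hz0 : f (a (z, ψ z)) = 0 := by
      have := hz.trans (congrArg f ha1)
      rwa [hf1] at this
    have hzH : a (z, ψ z) ∈ Hor ∩ W := by
      rw [hHW]
      exact ⟨hzW.1, hz0⟩
    simp only [inv_inv]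
    exact ⟨hzH.1, hzW.2⟩

theorem eventually_connForm_mem (hP : IsPrincipalBundle E EG EB G Q)
    (hU : IsConnectionDomain E EG γ Hor U) {q₀ q₁ : Q} (h : (q₀, q₁) ∈ Hor ∩ U) :
    ∀ᶠ z : Q × Q in 𝓝 (q₀, q₁),
      (z.1, (connForm G (Hor ∩ U) z.1 z.2)⁻¹ • z.2) ∈ Hor ∩ U := by
  obtain ⟨A, -, hA⟩ := hU.exists_local_connForm hP h
  filter_upwards [hA] with z hz
  rwa [connForm_eq_of_mem hU.unique hz]

theorem mdifferentiableAt_connForm (hP : IsPrincipalBundle E EG EB G Q)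
    (hU : IsConnectionDomain E EG γ Hor U) {q₀ q₁ : Q} (h : (q₀, q₁) ∈ Hor ∩ U) :
    MDifferentiableAt (𝓘(ℝ, E).prod 𝓘(ℝ, E)) 𝓘(ℝ, EG)
      (fun z : Q × Q => connForm G (Hor ∩ U) z.1 z.2) (q₀, q₁) := by
  obtain ⟨A, hAd, hA⟩ := hU.exists_local_connForm hP h
  exact hAd.congr_of_eventuallyEq (hA.mono fun z hz => connForm_eq_of_mem hU.unique hz)

/-- With `s` a local section of `π` through `q₁`, the lift of `r` at `x` is `𝒜_d(x, s(r))⁻¹ • s(r)`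
near the base point. -/
theorem mdifferentiableAt_discreteLift (hP : IsPrincipalBundle E EG EB G Q)
    (hU : IsConnectionDomain E EG γ Hor U) {q₀ q₁ : Q} (h : (q₀, q₁) ∈ Hor ∩ U) :
    MDifferentiableAt (𝓘(ℝ, E).prod 𝓘(ℝ, EB)) 𝓘(ℝ, E)
      (fun z : Q × MulAction.orbitRel.Quotient G Q => discreteLift (Hor ∩ U) z.1 z.2)
      (q₀, proj G q₁) := by
  obtain ⟨s, -, hs, -, hsq, hps, -, -⟩ := hP.exists_local_section q₁
  have hs' := hs.mdifferentiableAt (by simp)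
  set b : Q × MulAction.orbitRel.Quotient G Q → Q × Q := fun z => (z.1, s z.2) with hb
  have hb1 : b (q₀, proj G q₁) = (q₀, q₁) := by simp [hb, hsq]
  have hbs : MDifferentiableAt (𝓘(ℝ, E).prod 𝓘(ℝ, EB)) 𝓘(ℝ, E)
      (fun z : Q × MulAction.orbitRel.Quotient G Q => s z.2) (q₀, proj G q₁) :=
    MDifferentiableAt.comp (g := s) (q₀, proj G q₁) hs' mdifferentiableAt_snd
  have hbd : MDifferentiableAt (𝓘(ℝ, E).prod 𝓘(ℝ, EB)) (𝓘(ℝ, E).prod 𝓘(ℝ, E)) b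
      (q₀, proj G q₁) := mdifferentiableAt_fst.prodMk hbs
  have hA := hU.mdifferentiableAt_connForm hP h
  rw [← hb1] at hA
  have hAb := hA.comp _ hbd
  have hinv := ((contMDiff_inv 𝓘(ℝ, EG) ∞ (G := G)).mdifferentiableAt (by simp)).comp _ hAb
  have hsm := (hP.contMDiff_smul.mdifferentiableAt (by simp)).comp _ (hinv.prodMk hbs)
  refine hsm.congr_of_eventuallyEq ?_
  have hev := hU.eventually_connForm_mem hP h
  rw [← hb1] at hev
  filter_upwards [hbd.continuousAt.eventually hev,
    (continuousAt_snd (p := (q₀, proj G q₁))).eventually hps] with z hz hzs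
  exact discreteLift_eq_of_mem hU.unique hz ((proj_smul _ _).trans hzs)

theorem mdifferentiableAt_checkL (hP : IsPrincipalBundle E EG EB G Q)
    (hU : IsConnectionDomain E EG γ Hor U) {q₀ q₁ : Q} (h : (q₀, q₁) ∈ Hor ∩ U)
    {L : Q × Q → ℝ} (hL : ContMDiff (𝓘(ℝ, E).prod 𝓘(ℝ, E)) 𝓘(ℝ, ℝ) ∞ L) (w : G) :
    MDifferentiableAt (𝓘(ℝ, E).prod (𝓘(ℝ, EG).prod 𝓘(ℝ, EB))) 𝓘(ℝ, ℝ)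
      (fun z : Q × G × MulAction.orbitRel.Quotient G Q => checkL L (Hor ∩ U) z.1 z.2.1 z.2.2)
      (q₀, w, proj G q₁) := by
  have h1 : MDifferentiableAt (𝓘(ℝ, E).prod (𝓘(ℝ, EG).prod 𝓘(ℝ, EB))) 𝓘(ℝ, E)
      (fun z : Q × G × MulAction.orbitRel.Quotient G Q => discreteLift (Hor ∩ U) z.1 z.2.2)
      (q₀, w, proj G q₁) :=
    MDifferentiableAt.comp (q₀, w, proj G q₁)
      (g := fun z : Q × MulAction.orbitRel.Quotient G Q => discreteLift (Hor ∩ U) z.1 z.2)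
      (f := fun z : Q × G × MulAction.orbitRel.Quotient G Q => (z.1, z.2.2))
      (hU.mdifferentiableAt_discreteLift hP h)
      (mdifferentiableAt_fst.prodMk mdifferentiableAt_snd.snd)
  have h2 := (hP.contMDiff_smul.mdifferentiableAt (by simp)).comp _
    (mdifferentiableAt_snd.fst.prodMk h1)
  exact (hL.mdifferentiableAt (by simp)).comp _ (mdifferentiableAt_fst.prodMk h2)

end IsConnectionDomain

end ConnectionDomain

/-! ### The reduced lagrangian and the reduced forces of a Chaplygin type symmetry group -/

section Chaplygin

variable {E EG EB : Type*} [NormedAddCommGroup E] [NormedSpace ℝ E] [FiniteDimensional ℝ E]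
  [NormedAddCommGroup EG] [NormedSpace ℝ EG] [FiniteDimensional ℝ EG]
  [NormedAddCommGroup EB] [NormedSpace ℝ EB]
  {G : Type*} [Group G] [TopologicalSpace G] [ChartedSpace EG G] [LieGroup 𝓘(ℝ, EG) ∞ G]
  {Q : Type*} [TopologicalSpace Q] [ChartedSpace E Q] [IsManifold 𝓘(ℝ, E) ∞ Q] [MulAction G Q]
  [ChartedSpace EB (MulAction.orbitRel.Quotient G Q)]
  {S : NonholonomicSystem E Q} {γ : Q → G} {U : Set (Q × Q)}

/-- All quotient lifts compute on representatives, so pulling `L̆_d` back along `π` in the first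
slot sets the group variable of `Ľ_d` to `1`. -/
theorem chaplyginL_proj (hC : IsChaplyginSymmetryGroup E EG S γ)
    (hU : IsConnectionDomain E EG γ S.Dd U) (x : Q) (r : MulAction.orbitRel.Quotient G Q) :
    chaplyginL hC hU (proj G x, r) = checkL S.Ld (S.Dd ∩ U) x (1 : G) r :=
  rfl

variable (hP : IsPrincipalBundle E EG EB G Q) (hC : IsChaplyginSymmetryGroup E EG S γ)
  (hU : IsConnectionDomain E EG γ S.Dd U) {q₀ q₁ : Q} (h : (q₀, q₁) ∈ S.Dd ∩ U)

-- Composing with a local section `s` through `q₀` expresses `L̆_d(r₀, r₁)` locally as `Ľ_d(s(r₀),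
-- 1, r₁)`.
include hP h in
theorem mdifferentiableAt_chaplyginL :
    MDifferentiableAt (𝓘(ℝ, EB).prod 𝓘(ℝ, EB)) 𝓘(ℝ, ℝ) (chaplyginL hC hU)
      (proj G q₀, proj G q₁) := by
  obtain ⟨s, -, hs, -, hsq, hps, -, -⟩ := hP.exists_local_section q₀
  have hs' := hs.mdifferentiableAt (by simp)
  have hsf : MDifferentiableAt (𝓘(ℝ, EB).prod 𝓘(ℝ, EB)) 𝓘(ℝ, E)
      (fun z : MulAction.orbitRel.Quotient G Q × MulAction.orbitRel.Quotient G Q => s z.1)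
      (proj G q₀, proj G q₁) :=
    MDifferentiableAt.comp (g := s) (proj G q₀, proj G q₁) hs' mdifferentiableAt_fst
  have hK := hU.mdifferentiableAt_checkL hP h S.contMDiff_Ld (1 : G)
  rw [← hsq] at hK
  have hc := hK.comp (proj G q₀, proj G q₁)
    (hsf.prodMk (mdifferentiableAt_const.prodMk mdifferentiableAt_snd))
  refine hc.congr_of_eventuallyEq ?_
  filter_upwards [(continuousAt_fst (p := (proj G q₀, proj G q₁))).eventually hps] with z hz
  change _ = checkL S.Ld (S.Dd ∩ U) (s z.1) (1 : G) z.2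
  rw [← chaplyginL_proj hC hU, hz]

-- At a horizontal pair with group variable `1`, the map `F̃₁` returns `q₁` and `𝒜_d = 1`. Both the
-- lift and the horizontal part then act trivially on `v ∈ D`: `h(dπ v) = v` is used once for each.
include hU h in
theorem checkForceMinus_one_apply {D : ∀ q : Q, Submodule ℝ (TangentSpace 𝓘(ℝ, E) q)}
    (hb : Function.Bijective (dprojHor E EB G D q₀)) {v : E} (hv : v ∈ (D q₀ : Submodule ℝ E)) :
    (checkForceMinus E EG EB D S.Ld (S.Dd ∩ U) q₀ (1 : G) (proj G q₁) : EB →ₗ[ℝ] ℝ)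
      ((mfderiv 𝓘(ℝ, E) 𝓘(ℝ, EB) (proj G : Q → MulAction.orbitRel.Quotient G Q) q₀ :
        E →L[ℝ] EB) v) =
    (mfderiv 𝓘(ℝ, EG) 𝓘(ℝ, ℝ) (fun w : G => checkL S.Ld (S.Dd ∩ U) q₀ w (proj G q₁)) 1 :
      EG →L[ℝ] ℝ)
      ((mfderiv 𝓘(ℝ, E) 𝓘(ℝ, EG) (fun x => connForm G (S.Dd ∩ U) x q₁) q₀ : E →L[ℝ] EG) v) := by
  have h1 : tildeF₁ (S.Dd ∩ U) q₀ (1 : G) (proj G q₁) = q₁ := by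
    rw [tildeF₁, one_smul, hU.discreteLift_proj h]
  have h2 := hU.connForm_eq_one h
  have h3 := horLift_eq hb hv rfl
  -- The tangent spaces depend on the point and on the group element, so these are generalized
  -- before substituting their values.
  have key : ∀ (y : Q) (g : G) (u : E), y = q₁ → g = 1 → u = v →
      (D₂checkL EG S.Ld (S.Dd ∩ U) q₀ g (proj G q₁) : EG →ₗ[ℝ] ℝ)
        ((mixedCurvMinus E EG EB G D (S.Dd ∩ U) q₀ y : E →ₗ[ℝ] EG) u) =
      (mfderiv 𝓘(ℝ, EG) 𝓘(ℝ, ℝ) (fun w : G => checkL S.Ld (S.Dd ∩ U) q₀ w (proj G q₁)) 1 :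
        EG →L[ℝ] ℝ)
        ((mfderiv 𝓘(ℝ, E) 𝓘(ℝ, EG) (fun x => connForm G (S.Dd ∩ U) x q₁) q₀ :
          E →L[ℝ] EG) v) := by
    rintro y g u rfl rfl rfl
    exact congrArg (fun x : E => (mfderiv 𝓘(ℝ, EG) 𝓘(ℝ, ℝ)
      (fun w : G => checkL S.Ld (S.Dd ∩ U) q₀ w (proj G y)) 1 : EG →L[ℝ] ℝ)
      ((mfderiv 𝓘(ℝ, E) 𝓘(ℝ, EG) (fun x => connForm G (S.Dd ∩ U) x y) q₀ : E →L[ℝ] EG) x)) h3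
  exact key _ _ _ h1 ((congrArg (connForm G (S.Dd ∩ U) q₀) h1).trans h2) h3

include hU h in
theorem checkForcePlus_one_apply {D : ∀ q : Q, Submodule ℝ (TangentSpace 𝓘(ℝ, E) q)}
    (hb : Function.Bijective (dprojHor E EB G D q₁)) {v : E} (hv : v ∈ (D q₁ : Submodule ℝ E)) :
    (checkForcePlus E EG EB D S.Ld (S.Dd ∩ U) q₀ (1 : G) (proj G q₁) : EB →ₗ[ℝ] ℝ)
      ((mfderiv 𝓘(ℝ, E) 𝓘(ℝ, EB) (proj G : Q → MulAction.orbitRel.Quotient G Q) q₁ :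
        E →L[ℝ] EB) v) =
    (mfderiv 𝓘(ℝ, EG) 𝓘(ℝ, ℝ) (fun w : G => checkL S.Ld (S.Dd ∩ U) q₀ w (proj G q₁)) 1 :
      EG →L[ℝ] ℝ)
      ((mfderiv 𝓘(ℝ, E) 𝓘(ℝ, EG) (fun y => connForm G (S.Dd ∩ U) q₀ y) q₁ : E →L[ℝ] EG) v) := by
  have h1 : tildeF₁ (S.Dd ∩ U) q₀ (1 : G) (proj G q₁) = q₁ := by
    rw [tildeF₁, one_smul, hU.discreteLift_proj h]
  have h2 := hU.connForm_eq_one h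
  have h3 := horLift_eq hb hv rfl
  -- Here the lift itself is based at the varying point `y`, so its value can be replaced by `v`
  -- only after `y` has become `q₁`.
  have key : ∀ (y : Q) (g : G), y = q₁ → g = 1 →
      (D₂checkL EG S.Ld (S.Dd ∩ U) q₀ g (proj G q₁) : EG →ₗ[ℝ] ℝ)
        ((mixedCurvPlus E EG EB G D (S.Dd ∩ U) q₀ y : E →ₗ[ℝ] EG)
          ((horLift E EB G D y : EB →ₗ[ℝ] E)
            ((mfderiv 𝓘(ℝ, E) 𝓘(ℝ, EB) (proj G : Q → MulAction.orbitRel.Quotient G Q) q₁ :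
              E →L[ℝ] EB) v))) =
      (mfderiv 𝓘(ℝ, EG) 𝓘(ℝ, ℝ) (fun w : G => checkL S.Ld (S.Dd ∩ U) q₀ w (proj G q₁)) 1 :
        EG →L[ℝ] ℝ)
        ((mfderiv 𝓘(ℝ, E) 𝓘(ℝ, EG) (fun y => connForm G (S.Dd ∩ U) q₀ y) q₁ :
          E →L[ℝ] EG) v) := by
    rintro y g rfl rfl
    have h4 : (horPart E EB G D y : E →ₗ[ℝ] E) ((horLift E EB G D y : EB →ₗ[ℝ] E)
        ((mfderiv 𝓘(ℝ, E) 𝓘(ℝ, EB) (proj G : Q → MulAction.orbitRel.Quotient G Q) y :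
          E →L[ℝ] EB) v)) = v :=
      (congrArg (fun x : E => (horPart E EB G D y : E →ₗ[ℝ] E) x) h3).trans h3
    exact congrArg (fun x : E => (mfderiv 𝓘(ℝ, EG) 𝓘(ℝ, ℝ)
      (fun w : G => checkL S.Ld (S.Dd ∩ U) q₀ w (proj G y)) 1 : EG →L[ℝ] ℝ)
      ((mfderiv 𝓘(ℝ, E) 𝓘(ℝ, EG) (fun z => connForm G (S.Dd ∩ U) q₀ z) y : E →L[ℝ] EG) x)) h4
  exact key _ _ h1 ((congrArg (connForm G (S.Dd ∩ U) q₀) h1).trans h2)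

-- Chain rule for `x ↦ Ľ_d(x, 𝒜_d(x, q₁), π(q₁))`. The membership `v ∈ 𝒟` serves only to recognize
-- the group term as the force.
include hP h in
theorem D₁_Ld_eq {v : E} (hv : v ∈ (S.D q₀ : Submodule ℝ E)) :
    (D₁ E S.Ld q₀ q₁ : E →ₗ[ℝ] ℝ) v =
      (D₁ EB (chaplyginL hC hU) (proj G q₀) (proj G q₁) +
        chaplyginForceMinus hP hC hU (proj G q₀) (proj G q₁) : EB →ₗ[ℝ] ℝ)
        ((mfderiv 𝓘(ℝ, E) 𝓘(ℝ, EB) (proj G : Q → MulAction.orbitRel.Quotient G Q) q₀ :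
          E →L[ℝ] EB) v) := by
  have hA1 := hU.connForm_eq_one h
  have hA : MDifferentiableAt 𝓘(ℝ, E) 𝓘(ℝ, EG) (fun x => connForm G (S.Dd ∩ U) x q₁) q₀ :=
    MDifferentiableAt.comp (f := fun x : Q => (x, q₁)) q₀ (hU.mdifferentiableAt_connForm hP h)
      (mdifferentiableAt_id.prodMk mdifferentiableAt_const)
  have hK : MDifferentiableAt (𝓘(ℝ, E).prod 𝓘(ℝ, EG)) 𝓘(ℝ, ℝ)
      (fun z : Q × G => checkL S.Ld (S.Dd ∩ U) z.1 z.2 (proj G q₁))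
      (q₀, connForm G (S.Dd ∩ U) q₀ q₁) := by
    rw [hA1]
    exact MDifferentiableAt.comp
      (f := fun z : Q × G => (z.1, z.2, proj G q₁)) (q₀, (1 : G))
      (hU.mdifferentiableAt_checkL hP h S.contMDiff_Ld (1 : G))
      (mdifferentiableAt_fst.prodMk (mdifferentiableAt_snd.prodMk mdifferentiableAt_const))
  have hcomp := HasMFDerivAt.comp (f := fun x => (x, connForm G (S.Dd ∩ U) x q₁)) q₀
    hK.hasMFDerivAt ((hasMFDerivAt_id q₀).prodMk hA.hasMFDerivAt)
  have hev : (fun x => S.Ld (x, q₁)) =ᶠ[𝓝 q₀]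
      (fun z : Q × G => checkL S.Ld (S.Dd ∩ U) z.1 z.2 (proj G q₁)) ∘
        fun x => (x, connForm G (S.Dd ∩ U) x q₁) := by
    have hc : ContinuousAt (fun x : Q => (x, q₁)) q₀ := continuousAt_id.prodMk continuousAt_const
    filter_upwards [hc.eventually (hU.eventually_connForm_mem hP h)] with x hx
    exact (checkL_connForm hU.unique S.Ld hx).symm
  have hD := (hcomp.congr_of_eventuallyEq hev).mfderiv
  -- With the group variable fixed at `1`, the function is `L̆_d(π(x), π(q₁))` by definition, so its
  -- derivative factors through `dπ`.
  have hb : HasMFDerivAt 𝓘(ℝ, E) 𝓘(ℝ, ℝ)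
      (fun x => checkL S.Ld (S.Dd ∩ U) x (1 : G) (proj G q₁)) q₀ _ :=
    HasMFDerivAt.comp (g := fun r => chaplyginL hC hU (r, proj G q₁)) q₀
      (MDifferentiableAt.comp (f := fun r => (r, proj G q₁)) (proj G q₀)
        (mdifferentiableAt_chaplyginL hP hC hU h)
        (mdifferentiableAt_id.prodMk mdifferentiableAt_const)).hasMFDerivAt
      (hP.contMDiff_proj.mdifferentiableAt (by simp)).hasMFDerivAt
  have hF := checkForceMinus_one_apply hU h (hP.bijective_dprojHor (hC.isCompl q₀)) hv
  -- Partial derivatives are split at the group element `𝒜_d(q₀, q₁)`, equal to `1` only as a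
  -- proposition.
  have hsplit : ∀ g : G, g = 1 → ∀ hg : MDifferentiableAt (𝓘(ℝ, E).prod 𝓘(ℝ, EG)) 𝓘(ℝ, ℝ)
      (fun z : Q × G => checkL S.Ld (S.Dd ∩ U) z.1 z.2 (proj G q₁)) (q₀, g), ∀ ξ : EG,
      (mfderiv (𝓘(ℝ, E).prod 𝓘(ℝ, EG)) 𝓘(ℝ, ℝ)
        (fun z : Q × G => checkL S.Ld (S.Dd ∩ U) z.1 z.2 (proj G q₁)) (q₀, g) :
        E × EG →L[ℝ] ℝ) (v, ξ) =
      (mfderiv 𝓘(ℝ, E) 𝓘(ℝ, ℝ)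
        (fun x => checkL S.Ld (S.Dd ∩ U) x (1 : G) (proj G q₁)) q₀ : E →L[ℝ] ℝ) v +
      (mfderiv 𝓘(ℝ, EG) 𝓘(ℝ, ℝ) (fun w : G => checkL S.Ld (S.Dd ∩ U) q₀ w (proj G q₁)) 1 :
        EG →L[ℝ] ℝ) ξ := by
    rintro g rfl hg ξ
    exact mfderiv_prod_apply hg v ξ
  have h1 := congrArg (fun T : E →L[ℝ] ℝ => T v) hD
  have h2 := congrArg (fun T : E →L[ℝ] ℝ => T v) hb.mfderiv
  exact h1.trans ((hsplit _ hA1 hK _).trans (congrArg₂ (fun a b : ℝ => a + b) h2 hF.symm))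

-- Now `x = q₀` is fixed and `y` enters `Ľ_d` through `π(y)` and `𝒜_d(q₀, y)`. The map `dπ` comes
-- directly from the chain rule.
include hP h in
theorem D₂_Ld_eq {v : E} (hv : v ∈ (S.D q₁ : Submodule ℝ E)) :
    (D₂ E S.Ld q₀ q₁ : E →ₗ[ℝ] ℝ) v =
      (D₂ EB (chaplyginL hC hU) (proj G q₀) (proj G q₁) +
        chaplyginForcePlus hP hC hU (proj G q₀) (proj G q₁) : EB →ₗ[ℝ] ℝ)
        ((mfderiv 𝓘(ℝ, E) 𝓘(ℝ, EB) (proj G : Q → MulAction.orbitRel.Quotient G Q) q₁ :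
          E →L[ℝ] EB) v) := by
  have hA1 := hU.connForm_eq_one h
  have hp := hP.contMDiff_proj.mdifferentiableAt (x := q₁) (by simp)
  have hA : MDifferentiableAt 𝓘(ℝ, E) 𝓘(ℝ, EG) (fun y => connForm G (S.Dd ∩ U) q₀ y) q₁ :=
    MDifferentiableAt.comp (f := fun y : Q => (q₀, y)) q₁ (hU.mdifferentiableAt_connForm hP h)
      (mdifferentiableAt_const.prodMk mdifferentiableAt_id)
  have hK : MDifferentiableAt (𝓘(ℝ, EB).prod 𝓘(ℝ, EG)) 𝓘(ℝ, ℝ)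
      (fun z : MulAction.orbitRel.Quotient G Q × G => checkL S.Ld (S.Dd ∩ U) q₀ z.2 z.1)
      (proj G q₁, connForm G (S.Dd ∩ U) q₀ q₁) := by
    rw [hA1]
    exact MDifferentiableAt.comp
      (f := fun z : MulAction.orbitRel.Quotient G Q × G => (q₀, z.2, z.1)) (proj G q₁, (1 : G))
      (hU.mdifferentiableAt_checkL hP h S.contMDiff_Ld (1 : G))
      (mdifferentiableAt_const.prodMk (mdifferentiableAt_snd.prodMk mdifferentiableAt_fst))
  have hcomp := HasMFDerivAt.comp (f := fun y => (proj G y, connForm G (S.Dd ∩ U) q₀ y)) q₁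
    hK.hasMFDerivAt (hp.hasMFDerivAt.prodMk hA.hasMFDerivAt)
  have hev : (fun y => S.Ld (q₀, y)) =ᶠ[𝓝 q₁]
      (fun z : MulAction.orbitRel.Quotient G Q × G => checkL S.Ld (S.Dd ∩ U) q₀ z.2 z.1) ∘
        fun y => (proj G y, connForm G (S.Dd ∩ U) q₀ y) := by
    have hc : ContinuousAt (fun y : Q => (q₀, y)) q₁ := continuousAt_const.prodMk continuousAt_id
    filter_upwards [hc.eventually (hU.eventually_connForm_mem hP h)] with y hy
    exact (checkL_connForm hU.unique S.Ld hy).symm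
  have hD := (hcomp.congr_of_eventuallyEq hev).mfderiv
  have hF := checkForcePlus_one_apply hU h (hP.bijective_dprojHor (hC.isCompl q₁)) hv
  have hsplit : ∀ g : G, g = 1 → ∀ hg : MDifferentiableAt (𝓘(ℝ, EB).prod 𝓘(ℝ, EG)) 𝓘(ℝ, ℝ)
      (fun z : MulAction.orbitRel.Quotient G Q × G => checkL S.Ld (S.Dd ∩ U) q₀ z.2 z.1)
      (proj G q₁, g), ∀ (w : EB) (ξ : EG),
      (mfderiv (𝓘(ℝ, EB).prod 𝓘(ℝ, EG)) 𝓘(ℝ, ℝ)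
        (fun z : MulAction.orbitRel.Quotient G Q × G => checkL S.Ld (S.Dd ∩ U) q₀ z.2 z.1)
        (proj G q₁, g) : EB × EG →L[ℝ] ℝ) (w, ξ) =
      (D₂ EB (chaplyginL hC hU) (proj G q₀) (proj G q₁) : EB →ₗ[ℝ] ℝ) w +
      (D₂checkL EG S.Ld (S.Dd ∩ U) q₀ (1 : G) (proj G q₁) : EG →ₗ[ℝ] ℝ) ξ := by
    rintro g rfl hg w ξ
    exact mfderiv_prod_apply hg w ξ
  have h1 := congrArg (fun T : E →L[ℝ] ℝ => T v) hD
  exact h1.trans ((hsplit _ hA1 hK _ _).trans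
    (congrArg (fun b : ℝ => (D₂ EB (chaplyginL hC hU) (proj G q₀) (proj G q₁) : EB →ₗ[ℝ] ℝ)
      ((mfderiv 𝓘(ℝ, E) 𝓘(ℝ, EB) (proj G : Q → MulAction.orbitRel.Quotient G Q) q₁ :
          E →L[ℝ] EB) v) + b) hF.symm))

end Chaplygin

end DiscreteMechanics

/-! ### Equivalence of the variational principles and the equations on `Q` and on `Q/G`. -/

theorem mainTheorem5
    {E EG EB : Type*}
    [NormedAddCommGroup E] [NormedSpace ℝ E] [FiniteDimensional ℝ E]
    [NormedAddCommGroup EG] [NormedSpace ℝ EG] [FiniteDimensional ℝ EG]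
    [NormedAddCommGroup EB] [NormedSpace ℝ EB] [FiniteDimensional ℝ EB]
    {G : Type*} [Group G] [TopologicalSpace G] [ChartedSpace EG G] [LieGroup 𝓘(ℝ, EG) ∞ G]
    {Q : Type*} [TopologicalSpace Q] [ChartedSpace E Q] [IsManifold 𝓘(ℝ, E) ∞ Q]
    [MulAction G Q] [ChartedSpace EB (MulAction.orbitRel.Quotient G Q)]
    [IsManifold 𝓘(ℝ, EB) ∞ (MulAction.orbitRel.Quotient G Q)]
    (hP : IsPrincipalBundle E EG EB G Q)
    (S : NonholonomicSystem E Q) (γ : Q → G)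
    (hC : IsChaplyginSymmetryGroup E EG S γ)
    (U : Set (Q × Q)) (hU : IsConnectionDomain E EG γ S.Dd U)
    (N : ℕ) (q : Fin (N + 1) → Q)
    (hq : ∀ k : Fin N, (q k.castSucc, q k.succ) ∈ S.Dd ∩ U) :
    List.TFAE [
      -- the discrete Lagrange-D'Alembert principle on Q
      ∀ δq : ∀ k, TangentSpace 𝓘(ℝ, E) (q k),
        δq 0 = 0 → δq (Fin.last N) = 0 → (∀ k, δq k ∈ S.D (q k)) →
        dAction E S.Ld q δq = 0,
      -- the discrete Lagrange-D'Alembert equations on Q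
      (∀ k : Fin (N - 1), ∀ v ∈ S.D (q (mid k)),
        (D₁ E S.Ld (q (mid k)) (q (next k)) +
          D₂ E S.Ld (q (prev k))
            (q (mid k))) v = 0) ∧
        ∀ k : Fin N, (q k.castSucc, q k.succ) ∈ S.Dd,
      -- the forced, unconstrained discrete variational principle on Q/G
      ∀ δr : ∀ k, TangentSpace 𝓘(ℝ, EB) (proj G (q k)),
        δr 0 = 0 → δr (Fin.last N) = 0 →
        dAction EB (chaplyginL hC hU) (fun k => proj G (q k)) δr =
          -∑ k : Fin (N - 1),
            (chaplyginForceMinus hP hC hU (proj G (q (mid k))) (proj G (q (next k))) +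
              chaplyginForcePlus hP hC hU (proj G (q (prev k))) (proj G (q (mid k))))
              (δr (mid k)),
      -- the forced discrete Euler-Lagrange equations on Q/G
      ∀ k : Fin (N - 1),
        D₁ EB (chaplyginL hC hU) (proj G (q (mid k))) (proj G (q (next k))) +
          D₂ EB (chaplyginL hC hU) (proj G (q (prev k))) (proj G (q (mid k))) =
          -(chaplyginForcePlus hP hC hU (proj G (q (prev k))) (proj G (q (mid k))) +
            chaplyginForceMinus hP hC hU (proj G (q (mid k))) (proj G (q (next k))))] := by
  have hL : ∀ k : Fin N, MDifferentiableAt (𝓘(ℝ, E).prod 𝓘(ℝ, E)) 𝓘(ℝ, ℝ) S.Ld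
      (q k.castSucc, q k.succ) := fun k => S.contMDiff_Ld.mdifferentiableAt (by simp)
  have hB : ∀ k : Fin N, MDifferentiableAt (𝓘(ℝ, EB).prod 𝓘(ℝ, EB)) 𝓘(ℝ, ℝ)
      (chaplyginL hC hU) (proj G (q k.castSucc), proj G (q k.succ)) :=
    fun k => mdifferentiableAt_chaplyginL hP hC hU (hq k)
  have hleft : ∀ k : Fin (N - 1), (q (prev k), q (mid k)) ∈ S.Dd ∩ U :=
    fun k => hq ⟨k, by omega⟩
  have hright : ∀ k : Fin (N - 1), (q (mid k), q (next k)) ∈ S.Dd ∩ U :=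
    fun k => hq ⟨k + 1, by omega⟩
  tfae_have 1 ↔ 2 := by
    -- The kinematic constraint in the second condition is part of the hypothesis on the curve.
    rw [and_iff_left fun k => (hq k).1, ← sum_mid_eq_zero_iff]
    refine forall_congr' fun δq => forall_congr' fun h0 => forall_congr' fun hN =>
      forall_congr' fun _ => ?_
    rw [dAction_eq_sum_mid hL δq h0 hN]
  tfae_have 2 ↔ 4 := by
    rw [and_iff_left fun k => (hq k).1]
    refine forall_congr' fun k => ?_
    have hbij := hP.bijective_dprojHor (hC.isCompl (q (mid k)))
    have key : ∀ v ∈ S.D (q (mid k)),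
        (D₁ E S.Ld (q (mid k)) (q (next k)) + D₂ E S.Ld (q (prev k)) (q (mid k))) v =
        (D₁ EB (chaplyginL hC hU) (proj G (q (mid k))) (proj G (q (next k))) +
          D₂ EB (chaplyginL hC hU) (proj G (q (prev k))) (proj G (q (mid k))) +
          (chaplyginForcePlus hP hC hU (proj G (q (prev k))) (proj G (q (mid k))) +
            chaplyginForceMinus hP hC hU (proj G (q (mid k))) (proj G (q (next k)))))
          (mfderiv 𝓘(ℝ, E) 𝓘(ℝ, EB) (proj G : Q → MulAction.orbitRel.Quotient G Q)
            (q (mid k)) v) := by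
      intro v hv
      have h1 := D₁_Ld_eq hP hC hU (hright k) hv
      have h2 := D₂_Ld_eq hP hC hU (hleft k) hv
      refine (congrArg₂ (fun a b : ℝ => a + b) h1 h2).trans ?_
      simp only [LinearMap.add_apply]
      ring
    rw [eq_neg_iff_add_eq_zero]
    constructor
    · intro h
      refine LinearMap.ext fun w => ?_
      -- Every tangent vector of `Q/G` is the projection of a vector of `𝒟`, so testing on `𝒟`
      -- determines the whole covector.
      obtain ⟨⟨v, hv⟩, rfl⟩ := hbij.2 w
      exact (key v hv).symm.trans (h v hv)
    · intro h v hv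
      rw [key v hv, h, LinearMap.zero_apply]
  tfae_have 3 ↔ 4 := by
    -- Variations on `Q/G` are unconstrained, so the same lemma applies with all of the tangent
    -- space; the forces are absorbed into the covectors.
    have hiff := sum_mid_eq_zero_iff (E := EB) (q := fun k => proj G (q k)) (D := fun _ => ⊤)
      (fun k => D₁ EB (chaplyginL hC hU) (proj G (q (mid k))) (proj G (q (next k))) +
        D₂ EB (chaplyginL hC hU) (proj G (q (prev k))) (proj G (q (mid k))) +
        (chaplyginForcePlus hP hC hU (proj G (q (prev k))) (proj G (q (mid k))) +
          chaplyginForceMinus hP hC hU (proj G (q (mid k))) (proj G (q (next k)))))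
    have h4 : ∀ k : Fin (N - 1), _ := fun k => eq_neg_iff_add_eq_zero
      (a := D₁ EB (chaplyginL hC hU) (proj G (q (mid k))) (proj G (q (next k))) +
        D₂ EB (chaplyginL hC hU) (proj G (q (prev k))) (proj G (q (mid k))))
      (b := chaplyginForcePlus hP hC hU (proj G (q (prev k))) (proj G (q (mid k))) +
        chaplyginForceMinus hP hC hU (proj G (q (mid k))) (proj G (q (next k))))
    rw [forall_congr' h4]
    refine Iff.trans ?_ (hiff.trans (forall_congr' fun k => ?_))
    · refine forall_congr' fun δr => forall_congr' fun h0 => forall_congr' fun hN => ?_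
      rw [dAction_eq_sum_mid (q := fun k => proj G (q k)) hB δr h0 hN, eq_neg_iff_add_eq_zero,
        ← Finset.sum_add_distrib]
      simp only [Submodule.mem_top, implies_true, forall_const]
      refine Eq.congr_left (Finset.sum_congr rfl fun k _ => ?_)
      simp only [LinearMap.add_apply]
      ring
    · simp only [Submodule.mem_top, forall_const]
      exact ⟨fun h => LinearMap.ext h, fun h v => by rw [h, LinearMap.zero_apply]⟩
  tfae_finish
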